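/- Let $\mathbb K$ be a field of characteristic zero and let $H_{CK}=\mathbb K[\mathcal T]$ be the Connes--Kreimer Hopf algebra: the polynomial algebra on the set $\mathcal T$ of non-empty (non-plane) rooted trees, whose monomials are identified with rooted forests, graded by the number of vertices, with coproduct the algebra morphism given on trees by $$\Delta(t)=t\otimes 1+1\otimes t+\sum_{c} P^c(t)\otimes R^c(t),$$ where $c$ runs over the non-empty admissible cuts of $t$ (sets of edges no two of which lie on the same path from the root to a leaf), $R^c(t)$ is the part containing the root after removing the edges in $c$, and $P^c(t)$ is the forest of the other parts. Let $\bullet$ be the bilinear product on $H_{CK}$ given on forests $f,f'$ by $$f\bullet f'=\sum_{s\in \mathrm{Vert}(f)}\text{(grafting of } f' \text{ on } s),$$ where grafting $f'$ on $s$ makes all roots of $f'$ children of $s$. Let $\mathcal Seq$ be the set of sequences $(t_n)_{n\ge1}$ of elements of $H_{CK}$ such that each $t_n$ is a nonzero linear combination of trees with $n$ vertices, $t_1$ is the one-vertex tree, and the subalgebra generated by the $t_n$ is a Hopf subalgebra of $H_{CK}$. For $(t_n)_{n\ge 1}\in\mathcal Seq$ the associated double sequence $(\lambda_{i,j})_{i,j\ge1}$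 is defined as follows: $\lambda_{i,j}$ is the coefficient of $t_j\otimes t_i$ in $\Delta(t_{i+j})$, written in the basis of tensors of monomials in the $t_n$. Proposition. Let $N\ge 1$ and let $t'_1,\dots,t'_N\in H_{CK}$ be such that $t'_1$ is the one-vertex tree, each $t'_i$ is a nonzero linear combination of trees with $i$ vertices, and $A=\mathbb K[t'_1,\dots,t'_N]$ is a Hopf subalgebra of $H_{CK}$. Let $X$ be a nonzero primitive element of $A$, homogeneous of degree $N$. Define $(t_n)_{n\ge1}$ by $t_n=t'_n$ if $n\le N$ and $t_n=t_{n-N}\bullet X$ if $n>N$. Then $(t_n)_{n\ge1}\in\mathcal Seq$. Moreover, its associated double sequence $(\lambda_{i,j})_{i,j\ge 1}$ satisfies, whenever $k+l>N$, $$\lambda_{k,l}=\lambda_{k-N,l}+\lambda_{k,l-N}+\alpha\,k\,\delta_{l,N},$$ with the convention $\lambda_{i,j}=0$ if $i\le0$ or $j\le0$, where $\alpha$ is the coefficient of $t_N$ in $X$, written as a polynomial in $t'_1,\dots,t'_N$. -/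

import Mathlib

open scoped TensorProduct

noncomputable section

/-! ### Rooted trees and forests -/

/-- Plane (ordered) rooted trees: a root with the list of the subtrees born from it. -/
inductive PlaneTree : Type
  | node : List PlaneTree → PlaneTree

/-- One reordering step: permute the children of the root, or make a step in one child. -/
inductive PlaneTree.Step : PlaneTree → PlaneTree → Prop
  | perm {l l' : List PlaneTree} : l.Perm l' → PlaneTree.Step (.node l) (.node l')
  | child {a b : PlaneTree} (l r : List PlaneTree) : PlaneTree.Step a b →
      PlaneTree.Step (.node (l ++ a :: r)) (.node (l ++ b :: r))

/-- Non-empty rooted trees without plane structure: plane rooted trees up to reordering the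
children of any vertices. -/
def RTree : Type := Quot PlaneTree.Step

/-- Rooted forests (multisets of rooted trees); `0` is the empty forest and `+` is the disjoint
union. -/
abbrev Forest : Type := Multiset RTree

namespace RTree

/-- The class of a plane rooted tree. -/
def mk (p : PlaneTree) : RTree := Quot.mk PlaneTree.Step p

/-- A choice of a plane representative. -/
def out (t : RTree) : PlaneTree := Quot.out t

theorem mk_out (t : RTree) : mk t.out = t := Quot.out_eq t

/-- `B₊` on forests: the tree whose root has the trees of the forest as children subtrees. -/
def node (F : Forest) : RTree :=
  Quotient.liftOn F (fun l : List RTree => mk (.node (l.map out)))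
    (fun _ _ h => Quot.sound (.perm (h.map _)))

theorem mk_node_congr (l l' : List PlaneTree) (h : l.map mk = l'.map mk) :
    mk (.node l) = mk (.node l') := by
  have key : ∀ (a b : PlaneTree), mk a = mk b → ∀ p r : List PlaneTree,
      mk (.node (p ++ a :: r)) = mk (.node (p ++ b :: r)) := by
    intro a b hab p r
    have hg := Quot.eqvGen_exact hab
    clear hab
    induction hg with
    | rel x y hxy => exact Quot.sound (.child p r hxy)
    | refl x => rfl
    | symm x y _ ih => exact ih.symm
    | trans x y z _ _ ih1 ih2 => exact ih1.trans ih2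
  have main : ∀ (l l' p : List PlaneTree), l.map mk = l'.map mk →
      mk (.node (p ++ l)) = mk (.node (p ++ l')) := by
    intro l
    induction l with
    | nil =>
      intro l' p h
      cases l' with
      | nil => rfl
      | cons b l' => simp at h
    | cons a l ih =>
      intro l' p h
      cases l' with
      | nil => simp at h
      | cons b l' =>
        simp only [List.map_cons, List.cons.injEq] at h
        have h1 := key a b h.1 p l
        have h2 := ih l' (p ++ [b]) h.2
        simp only [List.append_assoc, List.cons_append, List.nil_append] at h2
        exact h1.trans h2
  exact main l l' [] h

theorem node_coe_map_mk (l : List PlaneTree) :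
    node (↑(l.map mk) : Multiset RTree) = mk (.node l) := by
  change mk (.node ((l.map mk).map out)) = _
  apply mk_node_congr
  simp only [List.map_map]
  apply List.map_congr_left
  intro a _
  exact mk_out (mk a)

/-- Structural recursion on plane trees, used for `RTree.recur`. -/
def planeRecur {α : Type*} (f : Multiset (RTree × α) → α) : PlaneTree → α
  | .node l => f (↑(l.attach.map (fun a => (mk a.1, planeRecur f a.1))) : Multiset (RTree × α))
termination_by p => p
decreasing_by
  have := List.sizeOf_lt_of_mem a.2
  simp only [PlaneTree.node.sizeOf_spec]
  omega

theorem planeRecur_node {α : Type*} (f : Multiset (RTree × α) → α) (l : List PlaneTree) :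
    planeRecur f (.node l) =
      f (↑(l.map (fun a => (mk a, planeRecur f a))) : Multiset (RTree × α)) := by
  rw [planeRecur]
  congr 2
  exact List.attach_map_val (f := fun a => (mk a, planeRecur f a))

theorem planeRecur_step {α : Type*} (f : Multiset (RTree × α) → α) (a b : PlaneTree)
    (h : PlaneTree.Step a b) : planeRecur f a = planeRecur f b := by
  induction h with
  | perm h =>
    rw [planeRecur_node, planeRecur_node]
    congr 1
    exact Multiset.coe_eq_coe.2 (h.map _)
  | @child a b l r h ih =>
    have hab : mk a = mk b := Quot.sound h
    rw [planeRecur_node, planeRecur_node]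
    simp only [List.map_append, List.map_cons, hab, ih]

/-- Recursion on rooted trees: `recur f (node F) = f {(t, recur f t) | t ∈ F}`
(with multiplicities), see `RTree.recur_node`. -/
def recur {α : Type*} (f : Multiset (RTree × α) → α) (t : RTree) : α :=
  Quot.liftOn t (planeRecur f) (planeRecur_step f)

theorem exists_map_mk (F : Forest) :
    ∃ l : List PlaneTree, F = (↑(l.map mk) : Multiset RTree) := by
  induction F using Quotient.inductionOn with
  | _ l =>
    refine ⟨l.map out, congrArg (fun l' : List RTree => (l' : Multiset RTree)) ?_⟩
    have : (mk ∘ out : RTree → RTree) = id := funext mk_out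
    rw [List.map_map, this, List.map_id]

theorem recur_node {α : Type*} (f : Multiset (RTree × α) → α) (F : Forest) :
    recur f (node F) = f (F.map (fun t => (t, recur f t))) := by
  obtain ⟨l, rfl⟩ := exists_map_mk F
  rw [node_coe_map_mk]
  change planeRecur f (.node l) = _
  rw [planeRecur_node, Multiset.map_coe, List.map_map]
  rfl

theorem induct {P : RTree → Prop} (h : ∀ F : Forest, (∀ t ∈ F, P t) → P (node F))
    (t : RTree) : P t := by
  have key : ∀ p : PlaneTree, P (mk p) := by
    intro p
    induction p using PlaneTree.rec (motive_2 := fun l => ∀ a ∈ l, P (mk a)) with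
    | node l ih =>
      rw [← node_coe_map_mk]
      apply h
      intro t ht
      obtain ⟨a, ha, rfl⟩ := List.mem_map.1 (Multiset.mem_coe.1 ht)
      exact ih a ha
    | nil a ha => cases ha
    | cons a l iha ihl b hb =>
      rcases List.mem_cons.1 hb with rfl | hb
      · exact iha
      · exact ihl b hb
  induction t using Quot.inductionOn with
  | _ p => exact key p

/-- The tree `•` with a single vertex. -/
def single : RTree := node 0

/-- The degree of a tree: its number of vertices. -/
def size : RTree → ℕ := recur (fun m => 1 + (m.map Prod.snd).sum)

theorem size_node (F : Forest) : size (node F) = 1 + (F.map size).sum := by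
  simp [size, recur_node, Multiset.map_map]

/-- The multiset of all pairs `(P^c(t), R^c(t))`, where `c` runs over the admissible cuts of `t`,
the empty cut included (it gives the pair `(∅, t)`).

An admissible cut of a tree amounts to the following choice, independently for each child
subtree `s` of the root: either cut the edge from the root to `s` (then no edge of `s` is cut, so
that `s` contributes the forest `{s}` to `P^c` and nothing to `R^c`), or keep this edge and choose
a possibly empty admissible cut `c'` of `s` (then `s` contributes the forest `P^{c'}(s)` to `P^c`
and the child `R^{c'}(s)` of the root to `R^c`). `Multiset.Sections` runs over these choices. -/
def cuts : RTree → Multiset (Forest × RTree) :=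
  recur (fun m =>
    (Multiset.Sections
      (m.map (fun p : RTree × Multiset (Forest × RTree) =>
        (({p.1}, 0) : Forest × Forest) ::ₘ p.2.map (fun c => (c.1, ({c.2} : Forest)))))).map
      (fun s : Multiset (Forest × Forest) => (s.sum.1, node s.sum.2)))

theorem cuts_node (F : Forest) :
    cuts (node F) =
      (Multiset.Sections
        (F.map (fun t => (({t}, 0) : Forest × Forest) ::ₘ
          (cuts t).map (fun c => (c.1, ({c.2} : Forest)))))).map
        (fun s : Multiset (Forest × Forest) => (s.sum.1, node s.sum.2)) := by
  simp [cuts, recur_node, Multiset.map_map]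

theorem size_pos (t : RTree) : 0 < size t := by
  induction t using induct with
  | h F _ => rw [size_node]; omega

theorem size_add_of_mem_cuts (t : RTree) :
    ∀ c ∈ cuts t, (c.1.map size).sum + size c.2 = size t := by
  induction t using induct with
  | h F ih =>
    intro c hc
    rw [cuts_node] at hc
    obtain ⟨s, hs, rfl⟩ := Multiset.mem_map.1 hc
    rw [Multiset.mem_sections] at hs
    simp only [size_node]
    have key : ((s.sum.1).map size).sum + ((s.sum.2).map size).sum = (F.map size).sum := by
      clear hc
      induction F using Multiset.induction_on generalizing s with
      | empty =>
        simp only [Multiset.map_zero, Multiset.rel_zero_left] at hs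
        subst hs
        simp
      | cons t F ihF =>
        rw [Multiset.map_cons, Multiset.rel_cons_left] at hs
        obtain ⟨d, s', hd, hs', rfl⟩ := hs
        have h1 := ihF (fun u hu => ih u (Multiset.mem_cons_of_mem hu)) s' hs'
        have h2 : (d.1.map size).sum + (d.2.map size).sum = size t := by
          rcases Multiset.mem_cons.1 hd with rfl | hd
          · simp
          · obtain ⟨e, he, rfl⟩ := Multiset.mem_map.1 hd
            simpa using ih t (Multiset.mem_cons_self t F) e he
        rw [Multiset.sum_cons, Prod.fst_add, Prod.snd_add, Multiset.map_add, Multiset.sum_add,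
          Multiset.map_add, Multiset.sum_add, Multiset.map_cons, Multiset.sum_cons, ← h1, ← h2]
        omega
    omega

theorem size_lt_of_mem_cuts {t u : RTree} {c : Forest × RTree} (hc : c ∈ cuts t)
    (hu : u ∈ c.1) : size u < size t := by
  have h1 := size_add_of_mem_cuts t c hc
  have h2 := size_pos c.2
  have h3 : size u ≤ (c.1.map size).sum :=
    Multiset.single_le_sum (fun _ _ => Nat.zero_le _) _ (Multiset.mem_map_of_mem size hu)
  omega

open Classical in
/-- The multiset, indexed by the vertices `s` of the tree `t`, of the trees obtained by grafting
all trees of the forest `f` on `s` (their roots become children of `s`): `s` is either the root,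
or a vertex of one of the child subtrees of the root. -/
def graft (f : Forest) : RTree → Multiset RTree :=
  recur (fun m =>
    node (m.map Prod.fst + f) ::ₘ
      m.bind (fun p => p.2.map (fun g => node (g ::ₘ (m.map Prod.fst).erase p.1))))

open Classical in
theorem graft_node (f F : Forest) :
    graft f (node F) = node (F + f) ::ₘ
      F.bind (fun t => (graft f t).map (fun g => node (g ::ₘ F.erase t))) := by
  simp [graft, recur_node, Multiset.map_map, Multiset.bind_map]

open Classical in
/-- The multiset, indexed by the vertices `s` of the forest `F`, of the forests obtained by
grafting the forest `f` on `s`. -/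
def graftForest (F f : Forest) : Multiset Forest :=
  F.bind (fun t => (graft f t).map (fun g => g ::ₘ F.erase t))

end RTree

/-! ### The Connes-Kreimer Hopf algebra and its pre-Lie product -/

/-- The algebra `K[𝒯]` underlying the Connes-Kreimer Hopf algebra: polynomials in the rooted
trees. -/
abbrev HCK (K : Type*) [Field K] : Type _ := MvPolynomial RTree K

namespace HCK

variable (K : Type*) [Field K]

/-- A rooted tree as an element of the Connes-Kreimer Hopf algebra. -/
def tree (t : RTree) : HCK K := MvPolynomial.X t

/-- A rooted forest as an element of the Connes-Kreimer Hopf algebra: the product of its trees. -/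
def ofForest (F : Forest) : HCK K := (F.map (tree K)).prod

/-- The coproduct: the algebra morphism with `Δ(t) = t ⊗ 1 + ∑_c P^c(t) ⊗ R^c(t)` on trees, where
`c` runs over the admissible cuts of `t`, the empty cut (which gives `1 ⊗ t`) included. -/
def comul : HCK K →ₐ[K] HCK K ⊗[K] HCK K :=
  MvPolynomial.aeval (fun t =>
    tree K t ⊗ₜ[K] 1 + ((RTree.cuts t).map (fun c => ofForest K c.1 ⊗ₜ[K] tree K c.2)).sum)

/-- The antipode on trees, `S(t) = - t - ∑_c S(P^c(t)) R^c(t)` with the sum over the non-empty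
admissible cuts of `t`; here the term `t` is the one of the empty cut. -/
def antipodeTree (t : RTree) : HCK K :=
  -((RTree.cuts t).attach.map (fun c =>
      (c.1.1.attach.map (fun u => antipodeTree u.1)).prod * tree K c.1.2)).sum
termination_by RTree.size t
decreasing_by exact RTree.size_lt_of_mem_cuts c.2 u.2

/-- The antipode, an algebra morphism since the algebra is commutative. -/
def antipode : HCK K →ₐ[K] HCK K := MvPolynomial.aeval (antipodeTree K)

theorem antipode_tree (t : RTree) :
    antipode K (tree K t) =
      -((RTree.cuts t).map (fun c => antipode K (ofForest K c.1) * tree K c.2)).sum := by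
  have h : ∀ F : Forest, antipode K (ofForest K F) = (F.map (antipodeTree K)).prod := by
    intro F
    simp [antipode, ofForest, tree, map_multiset_prod, Multiset.map_map, Function.comp_def]
  simp only [h]
  rw [tree, antipode, MvPolynomial.aeval_X, antipodeTree]
  congr 2
  rw [← Multiset.attach_map_val' (RTree.cuts t)
    (fun c => (c.1.map (antipodeTree K)).prod * tree K c.2)]
  refine Multiset.map_congr rfl fun c _ => ?_
  rw [Multiset.attach_map_val' c.1.1 (antipodeTree K)]

/-- The pre-Lie product: the bilinear map with `f • f' = ∑_{s ∈ Vert(f)} (f' grafted on s)` for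
all forests `f` and `f'` (monomials, which are a basis). -/
def preLie : HCK K →ₗ[K] HCK K →ₗ[K] HCK K :=
  (MvPolynomial.basisMonomials RTree K).constr K (fun f =>
    (MvPolynomial.basisMonomials RTree K).constr K (fun f' =>
      ((RTree.graftForest (Finsupp.toMultiset f) (Finsupp.toMultiset f')).map (ofForest K)).sum))

variable {K}

/-- `A` is a Hopf subalgebra: a subalgebra with `Δ(A) ⊆ A ⊗ A` and `S(A) ⊆ A`. -/
def IsHopfSubalgebra (A : Subalgebra K (HCK K)) : Prop :=
  (∀ a ∈ A, comul K a ∈ (Algebra.TensorProduct.map A.val A.val).range) ∧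
    ∀ a ∈ A, antipode K a ∈ A

/-- Primitive elements of the Connes-Kreimer Hopf algebra. -/
def IsPrimitive (x : HCK K) : Prop := comul K x = x ⊗ₜ[K] 1 + 1 ⊗ₜ[K] x

/-- `x` is a nonzero linear combination of trees of degree `n`. -/
def IsNonzeroTreeComb (n : ℕ) (x : HCK K) : Prop :=
  x ≠ 0 ∧ x ∈ Submodule.span K (tree K '' {t | RTree.size t = n})

/-- `x` is homogeneous of degree `n` for the grading by the number of vertices. -/
def IsHomogeneousOfDegree (n : ℕ) (x : HCK K) : Prop :=
  MvPolynomial.IsWeightedHomogeneous RTree.size x n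

/-- The set `𝒮eq` of sequences `(t_n)_{n ≥ 1}` with `t_1 = •`, each `t_n` a nonzero linear
combination of trees of degree `n`, and generating a Hopf subalgebra. -/
def Seq (K : Type*) [Field K] : Set (ℕ+ → HCK K) :=
  {t | (∀ n : ℕ+, IsNonzeroTreeComb (n : ℕ) (t n)) ∧ t 1 = tree K RTree.single ∧
    IsHopfSubalgebra (Algebra.adjoin K (Set.range t))}

/-- `c` is the coefficient of the generator `t i` in `x`, when `x` is written as a polynomial in
the generators `t`. -/
def IsGenCoeff {ι : Type*} (t : ι → HCK K) (x : HCK K) (i : ι) (c : K) : Prop :=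
  ∃ P : MvPolynomial ι K, MvPolynomial.aeval t P = x ∧ P.coeff (Finsupp.single i 1) = c

/-- `lam` is the double sequence associated with `t`: `lam i j` is the coefficient of `t_j ⊗ t_i`
in `Δ(t_n)`, `n = i + j`, when `Δ(t_n)` is written as a linear combination of tensors
`m ⊗ m'` of monomials `m`, `m'` in the generators `t_1, t_2, …`. -/
def IsLambdaArray (t : ℕ+ → HCK K) (lam : ℕ+ → ℕ+ → K) : Prop :=
  ∀ n : ℕ+, ∃ Q : MvPolynomial ℕ+ K ⊗[K] MvPolynomial ℕ+ K,
    Algebra.TensorProduct.map (MvPolynomial.aeval t) (MvPolynomial.aeval t) Q = comul K (t n) ∧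
    ∀ i j : ℕ+, i + j = n →
      lam i j =
        ((MvPolynomial.basisMonomials ℕ+ K).tensorProduct
          (MvPolynomial.basisMonomials ℕ+ K)).repr Q (Finsupp.single j 1, Finsupp.single i 1)

/-- The sequence with `t_n = t'_n` for `n ≤ N` and `t_n = t_{n-N} • X` for `n > N`. -/
def extendSeq (N : ℕ+) (t' : {n : ℕ+ // n ≤ N} → HCK K) (X : HCK K) (n : ℕ+) : HCK K :=
  if h : n ≤ N then t' ⟨n, h⟩ else preLie K (extendSeq N t' X (n - N)) X
termination_by (n : ℕ)
decreasing_by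
  have h1 : (N : ℕ) < n := by exact_mod_cast not_le.1 h
  have h2 := N.pos
  rw [PNat.sub_coe, if_pos (not_le.1 h)]
  omega

end HCK

/-- A double sequence indexed by positive integers, extended to integer indices with the
convention `lam i j = 0` if `i ≤ 0` or `j ≤ 0`. -/
def extendByZero {K : Type*} [Zero K] (lam : ℕ+ → ℕ+ → K) (i j : ℤ) : K :=
  if 0 < i ∧ 0 < j then lam i.toNat.toPNat' j.toNat.toPNat' else 0

end

noncomputable section

namespace RTree

/-! For fixed `X`, the map `D : g ↦ g • X` is a derivation, because each vertex of a forest lies in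
exactly one of its trees. Let `E` be the derivation multiplying a forest by its number of vertices.
The heart of the proof is the identity, valid for primitive `X`, `Δ ∘ D = (D ⊗ id + id ⊗ D + (X * ·)
⊗ E) ∘ Δ` (`comul_graftDer`). Cut a forest after grafting `X` on a vertex `s`. Either `s` falls in
the pruned part, or it falls in the remaining part; in the latter case `X`, being primitive, either
stays whole on `s` or is cut off whole and joins the left factor. This last case occurs once for
each vertex of the right factor, whence `E`. The formal proof is an induction on trees through the
cocycle identity of `B₊` (`comul_bplus`).

Since `D t_n = t_{n+N}`, `E t_n = n t_n` and `X` is a polynomial in the `t_n`, the operator on the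
right preserves tensors of polynomials in the `t_n`. So `Δ(t_{n+N})` inherits this form from
`Δ(t_n)` (`comul_mem_range`), and stability under the antipode follows by induction on the degree
(`isHopfSubalgebra_adjoin`). The `t_n` stay nonzero by comparing numbers of trees in forests
(`preLie_ne_zero`).

The `t_n` are algebraically independent (`exists_leftInverse_aeval`), so everything transfers to
`K[X_1, X_2, …]`, where `D` is `X_n ↦ X_{n+N}` and `E` is `X_n ↦ n X_n`. Reading off linear
coefficients, the three summands of the operator give `λ_{k,l-N}`, `λ_{k-N,l}` and `α k δ_{l,N}`
respectively (`lambda_of_add_eq`). -/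

theorem exists_node (t : RTree) : ∃ F, t = node F :=
  induct (P := fun t => ∃ F, t = node F) (fun F _ => ⟨F, rfl⟩) t

theorem size_of_mem_graft (f : Forest) (t : RTree) :
    ∀ g ∈ graft f t, size g = size t + (f.map size).sum := by
  classical
  induction t using induct with
  | h F ih =>
    intro g hg
    rw [graft_node, Multiset.mem_cons] at hg
    rcases hg with rfl | hg
    · simp only [size_node, Multiset.map_add, Multiset.sum_add]
      omega
    · obtain ⟨t, ht, hg⟩ := Multiset.mem_bind.1 hg
      obtain ⟨u, hu, rfl⟩ := Multiset.mem_map.1 hg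
      obtain ⟨F', rfl⟩ := Multiset.exists_cons_of_mem ht
      have := ih t ht u (by convert hu)
      simp only [size_node, Multiset.map_cons, Multiset.sum_cons]
      rw [Multiset.erase_cons_head]
      omega

end RTree

namespace HCK

open RTree TensorProduct

/-! ### Grafting as a derivation, and the operator `B₊`. -/

section Grafting

variable (K : Type*) [Field K]

theorem ofForest_zero : ofForest K 0 = 1 := by simp [ofForest]

theorem ofForest_cons (t : RTree) (F : Forest) :
    ofForest K (t ::ₘ F) = tree K t * ofForest K F := by simp [ofForest]

theorem ofForest_add (F G : Forest) :
    ofForest K (F + G) = ofForest K F * ofForest K G := by simp [ofForest]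

theorem ofForest_toMultiset (f : RTree →₀ ℕ) :
    ofForest K (Finsupp.toMultiset f) = MvPolynomial.monomial f 1 := by
  rw [ofForest, Finsupp.toMultiset_map, Finsupp.prod_toMultiset, MvPolynomial.monomial_eq,
    Finsupp.prod_mapDomain_index (fun _ => pow_zero _) (fun _ _ _ => pow_add _ _ _)]
  simp [tree]

variable {K} in
theorem hom_ext_ofForest {M : Type*} [AddCommMonoid M] [Module K M] {f g : HCK K →ₗ[K] M}
    (h : ∀ F, f (ofForest K F) = g (ofForest K F)) : f = g := by
  refine (MvPolynomial.basisMonomials RTree K).ext fun m => ?_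
  have := h (Finsupp.toMultiset m)
  rwa [ofForest_toMultiset] at this

variable {K} in
theorem induction_ofForest {P : HCK K → Prop} (h : ∀ F, P (ofForest K F))
    (hadd : ∀ x y, P x → P y → P (x + y)) (hsmul : ∀ (c : K) x, P x → P (c • x)) (x : HCK K) :
    P x := by
  induction x using MvPolynomial.induction_on' with
  | monomial u a =>
    have := hsmul a _ (h (Finsupp.toMultiset u))
    rwa [ofForest_toMultiset, MvPolynomial.smul_monomial, smul_eq_mul, mul_one] at this
  | add p q hp hq => exact hadd p q hp hq

/-- The grafting operator `B₊`, sending a forest to the tree obtained by adding a root. -/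
def bplus : HCK K →ₗ[K] HCK K :=
  (MvPolynomial.basisMonomials RTree K).constr K (fun f => tree K (node (Finsupp.toMultiset f)))

theorem bplus_ofForest (F : Forest) : bplus K (ofForest K F) = tree K (node F) := by
  classical
  have h : Finsupp.toMultiset (Multiset.toFinsupp F) = F := Multiset.toFinsupp_toMultiset F
  rw [← h, ofForest_toMultiset]
  exact (MvPolynomial.basisMonomials RTree K).constr_basis K _ _

theorem preLie_ofForest (F G : Forest) :
    preLie K (ofForest K F) (ofForest K G) = ((graftForest F G).map (ofForest K)).sum := by
  classical
  have h : ∀ F, Finsupp.toMultiset (Multiset.toFinsupp F) = F :=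
    fun F : Forest => Multiset.toFinsupp_toMultiset F
  conv_lhs => rw [← h F, ← h G]
  rw [ofForest_toMultiset, ofForest_toMultiset, ← h F, ← h G]
  refine (LinearMap.congr_fun ((MvPolynomial.basisMonomials RTree K).constr_basis K _ _) _).trans ?_
  rw [h, h]
  refine ((MvPolynomial.basisMonomials RTree K).constr_basis K _ _).trans ?_
  rw [h, h]

theorem preLie_tree_ofForest (t : RTree) (G : Forest) :
    preLie K (tree K t) (ofForest K G) = ((graft G t).map (tree K)).sum := by
  have h : tree K t = ofForest K {t} := by simp [ofForest]
  rw [h, preLie_ofForest, graftForest]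
  simp [ofForest, Multiset.map_map, Function.comp_def]

variable {K}

/-- The derivation extending `t ↦ t • x` from the trees. -/
def graftDer (x : HCK K) : Derivation K (HCK K) (HCK K) :=
  MvPolynomial.mkDerivation K (fun t => preLie K (tree K t) x)

theorem graftDer_tree (x : HCK K) (t : RTree) : graftDer x (tree K t) = preLie K (tree K t) x :=
  MvPolynomial.mkDerivation_X _ _ _

open Classical in
theorem derivation_ofForest (D : Derivation K (HCK K) (HCK K)) (F : Forest) :
    D (ofForest K F) = (F.map (fun t => D (tree K t) * ofForest K (F.erase t))).sum := by
  induction F using Multiset.induction_on with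
  | empty => simp [ofForest_zero]
  | cons a F ih =>
    have h : F.map (fun t => D (tree K t) * ofForest K ((a ::ₘ F).erase t)) =
        F.map (fun t => tree K a * (D (tree K t) * ofForest K (F.erase t))) := by
      refine Multiset.map_congr rfl fun t ht => ?_
      rw [Multiset.erase_cons_tail_of_mem ht, ofForest_cons]
      ring
    rw [ofForest_cons, Derivation.leibniz, Multiset.map_cons, Multiset.sum_cons, h,
      Multiset.sum_map_mul_left, ih, Multiset.erase_cons_head, smul_eq_mul, smul_eq_mul, add_comm,
      mul_comm (ofForest K F)]

/-- Sorting the vertices of `F` by the tree containing them is the Leibniz rule: the other trees are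
left untouched by the grafting. -/
theorem graftDer_ofForest (F G : Forest) :
    graftDer (ofForest K G) (ofForest K F) = ((graftForest F G).map (ofForest K)).sum := by
  classical
  rw [derivation_ofForest, graftForest, Multiset.map_bind, Multiset.sum_bind]
  congr 1
  refine Multiset.map_congr rfl fun t _ => ?_
  rw [graftDer_tree, preLie_tree_ofForest, Multiset.map_map, ← Multiset.sum_map_mul_right]
  simp only [Function.comp_def, ofForest_cons]

theorem graftDer_eq_preLie (x y : HCK K) : graftDer x y = preLie K y x := by
  have h : ∀ G : Forest, (graftDer (ofForest K G) : HCK K →ₗ[K] HCK K) =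
      (preLie K).flip (ofForest K G) := fun G => hom_ext_ofForest fun F => by
    simpa using (graftDer_ofForest F G).trans (preLie_ofForest K F G).symm
  have hadd : ∀ x y, graftDer (x + y) = graftDer x + graftDer (K := K) y := fun x y =>
    MvPolynomial.derivation_ext fun t => by
      simp only [Derivation.add_apply, ← tree.eq_def, graftDer_tree, map_add]
  have hsmul : ∀ (c : K) (x : HCK K), graftDer (c • x) = c • graftDer x := fun c x =>
    MvPolynomial.derivation_ext fun t => by
      simp only [Derivation.smul_apply, ← tree.eq_def, graftDer_tree, map_smul]
  induction x using induction_ofForest with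
  | h G => exact LinearMap.congr_fun (h G) y
  | hadd x z hx hz => simp [hadd, hx, hz]
  | hsmul c x hx => simp [hsmul, hx]

/-- The grafting vertex is either the new root, which gives `g * x`, or a vertex of `g`. -/
theorem graftDer_bplus (x g : HCK K) :
    graftDer x (bplus K g) = bplus K (g * x + graftDer x g) := by
  classical
  simp only [graftDer_eq_preLie]
  induction g using induction_ofForest with
  | hadd y z hy hz => simp only [map_add, LinearMap.add_apply, hy, hz, add_mul]; abel
  | hsmul c y hy => simp only [map_smul, LinearMap.smul_apply, hy, map_add, smul_add, smul_mul_assoc]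
  | h F =>
    induction x using induction_ofForest with
    | hadd y z hy hz => simp only [map_add, hy, hz, mul_add]; abel
    | hsmul c y hy => simp only [map_smul, hy, map_add, smul_add, mul_smul_comm]
    | h G =>
      rw [bplus_ofForest, preLie_tree_ofForest, preLie_ofForest, map_add, ← ofForest_add,
        bplus_ofForest, graft_node, Multiset.map_cons, Multiset.sum_cons, map_multiset_sum,
        graftForest, Multiset.map_map, Multiset.map_bind, Multiset.map_bind]
      simp only [Multiset.map_map, Function.comp_def, bplus_ofForest]

variable (K) in
/-- The derivation multiplying each forest by its degree. -/
def degreeDer : Derivation K (HCK K) (HCK K) :=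
  MvPolynomial.mkDerivation K (fun t => (size t : K) • tree K t)

theorem degreeDer_tree (t : RTree) : degreeDer K (tree K t) = (size t : K) • tree K t :=
  MvPolynomial.mkDerivation_X _ _ _

theorem degreeDer_ofForest (F : Forest) :
    degreeDer K (ofForest K F) = ((F.map size).sum : K) • ofForest K F := by
  induction F using Multiset.induction_on with
  | empty => simp [ofForest_zero]
  | cons a F ih =>
    rw [ofForest_cons, Derivation.leibniz, degreeDer_tree, ih, Multiset.map_cons,
      Multiset.sum_cons]
    push_cast
    simp only [smul_eq_mul, mul_smul_comm, add_smul]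
    rw [add_comm, mul_comm (ofForest K F)]

theorem degreeDer_bplus (g : HCK K) :
    degreeDer K (bplus K g) = bplus K (g + degreeDer K g) := by
  induction g using induction_ofForest with
  | hadd y z hy hz => simp only [map_add, hy, hz]; abel
  | hsmul c y hy =>
    simp only [map_smul, Derivation.map_smul, hy, map_add, smul_add]
  | h F =>
    rw [bplus_ofForest, degreeDer_tree, degreeDer_ofForest, map_add, map_smul, bplus_ofForest,
      size_node]
    push_cast
    rw [add_smul, one_smul]

variable (K) in
-- Expanding the product of the coproducts of the children amounts to choosing one term per child,
-- which is what `Multiset.Sections` enumerates.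
theorem sum_cuts_node (F : Forest) :
    ((cuts (node F)).map (fun c => ofForest K c.1 ⊗ₜ[K] tree K c.2)).sum =
      TensorProduct.map LinearMap.id (bplus K) (comul K (ofForest K F)) := by
  have hF : comul K (ofForest K F) = (F.map (fun t => comul K (tree K t))).prod := by
    rw [ofForest, map_multiset_prod, Multiset.map_map]; rfl
  -- The term `t ⊗ 1` records that the edge above `t` is cut; the other terms are the admissible
  -- cuts of `t` with that edge kept.
  have ht : ∀ t : RTree, comul K (tree K t) =
      (((({t}, 0) : Forest × Forest) ::ₘ
          (cuts t).map (fun c => (c.1, ({c.2} : Forest)))).map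
        (fun s => ofForest K s.1 ⊗ₜ[K] ofForest K s.2)).sum := by
    intro t
    rw [comul, tree, MvPolynomial.aeval_X, Multiset.map_cons, Multiset.sum_cons, Multiset.map_map]
    simp [ofForest, Function.comp_def]
  have hs : ∀ s : Multiset (Forest × Forest),
      (s.map (fun s => ofForest K s.1 ⊗ₜ[K] ofForest K s.2)).prod =
        ofForest K s.sum.1 ⊗ₜ[K] ofForest K s.sum.2 := by
    intro s
    induction s using Multiset.induction_on with
    | empty => simp [ofForest_zero, Algebra.TensorProduct.one_def]
    | cons a s ih =>
      rw [Multiset.map_cons, Multiset.prod_cons, ih, Multiset.sum_cons, Prod.fst_add,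
        Prod.snd_add, ofForest_add, ofForest_add, Algebra.TensorProduct.tmul_mul_tmul]
  have key : ∀ m : Multiset (Multiset (Forest × Forest)),
      (m.map (fun u => (u.map (fun s => ofForest K s.1 ⊗ₜ[K] ofForest K s.2)).sum)).prod =
        ((Multiset.Sections m).map
          (fun s => ofForest K s.sum.1 ⊗ₜ[K] ofForest K s.sum.2)).sum := by
    intro m
    simp only [← hs]
    induction m using Multiset.induction_on with
    | empty => simp
    | cons u m ih =>
      rw [Multiset.map_cons, Multiset.prod_cons, ih, Multiset.sections_cons, Multiset.map_bind,
        Multiset.sum_bind, ← Multiset.sum_map_mul_right]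
      congr 1
      refine Multiset.map_congr rfl fun a _ => ?_
      rw [Multiset.map_map, ← Multiset.sum_map_mul_left]
      congr 1
      exact Multiset.map_congr rfl fun s _ => by simp
  simp only [hF, ht]
  have := key (F.map (fun t => (({t}, 0) : Forest × Forest) ::ₘ
          (cuts t).map (fun c => (c.1, ({c.2} : Forest)))))
  rw [Multiset.map_map] at this
  simp only [Function.comp_def] at this
  rw [this, map_multiset_sum, Multiset.map_map, cuts_node, Multiset.map_map]
  simp only [Function.comp_def, TensorProduct.map_tmul, LinearMap.id_apply, bplus_ofForest]

/-- `B₊` is a Hochschild 1-cocycle; this is what allows identities on the coproduct to be proved by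
induction on trees. -/
theorem comul_bplus (g : HCK K) :
    comul K (bplus K g) =
      bplus K g ⊗ₜ[K] 1 + TensorProduct.map LinearMap.id (bplus K) (comul K g) := by
  induction g using induction_ofForest with
  | hadd y z hy hz => simp only [map_add, hy, hz, TensorProduct.add_tmul]; abel
  | hsmul c y hy => simp only [map_smul, hy, smul_add, TensorProduct.smul_tmul']
  | h F =>
    rw [← sum_cuts_node, bplus_ofForest]
    exact MvPolynomial.aeval_X _ _

end Grafting

end HCK

namespace RTree

/-- The forest of the subtrees born from the root. -/
def children : RTree → Forest := recur (fun m => m.map Prod.fst)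

theorem children_node (F : Forest) : children (node F) = F := by
  simp [children, recur_node, Multiset.map_map]

end RTree

/-! ### The operator on `R ⊗ R` that lifts grafting through the coproduct. -/

section CoproductDerivation

variable {K R : Type*} [CommRing K] [CommRing R] [Algebra K R]

/-- The derivation `D ⊗ id + id ⊗ D + x ⊗ E` of `R ⊗ R`, as a linear map. -/
def tensorDer (D E : Derivation K R R) (x : R) : R ⊗[K] R →ₗ[K] R ⊗[K] R :=
  TensorProduct.map D LinearMap.id + TensorProduct.map LinearMap.id D +
    TensorProduct.map (LinearMap.mulLeft K x) E

theorem tensorDer_tmul (D E : Derivation K R R) (x a b : R) :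
    tensorDer D E x (a ⊗ₜ b) = D a ⊗ₜ b + a ⊗ₜ D b + (x * a) ⊗ₜ E b := by
  simp [tensorDer]

theorem tensorDer_mul (D E : Derivation K R R) (x : R) (u v : R ⊗[K] R) :
    tensorDer D E x (u * v) = tensorDer D E x u * v + u * tensorDer D E x v := by
  induction u with
  | zero => simp
  | add u₁ u₂ h₁ h₂ => rw [add_mul, map_add, h₁, h₂, map_add]; ring
  | tmul a b =>
    induction v with
    | zero => simp
    | add v₁ v₂ h₁ h₂ => rw [mul_add, map_add, h₁, h₂, map_add]; ring
    | tmul c d =>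
      simp only [Algebra.TensorProduct.tmul_mul_tmul, tensorDer_tmul, Derivation.leibniz,
        smul_eq_mul, TensorProduct.add_tmul, TensorProduct.tmul_add, add_mul, mul_add]
      rw [mul_comm c (D a), mul_comm d (D b), mul_comm d (E b), mul_assoc x a c,
        mul_left_comm a x c]
      abel

end CoproductDerivation

namespace HCK

open RTree TensorProduct

variable {K : Type*} [Field K]

theorem bplus_injective : Function.Injective (bplus K) := by
  -- A left inverse that deletes the root. Only its values on single trees matter.
  let L : HCK K →ₗ[K] HCK K := (MvPolynomial.basisMonomials RTree K).constr K
    (fun f => ((Finsupp.toMultiset f).map (fun t => ofForest K (children t))).sum)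
  have hL : ∀ t, L (tree K t) = ofForest K (children t) := fun t =>
    ((MvPolynomial.basisMonomials RTree K).constr_basis K _ (Finsupp.single t 1)).trans
      (by simp)
  have h : L ∘ₗ bplus K = LinearMap.id := hom_ext_ofForest fun F => by
    simp [bplus_ofForest, hL, children_node]
  exact Function.LeftInverse.injective (g := L) (LinearMap.congr_fun h)

theorem exists_bplus_of_mem_span {s : Set RTree} {y : HCK K}
    (hy : y ∈ Submodule.span K (tree K '' s)) : ∃ g, bplus K g = y := by
  have h : Submodule.span K (tree K '' s) ≤ LinearMap.range (bplus K) := by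
    rw [Submodule.span_le]
    rintro _ ⟨t, _, rfl⟩
    obtain ⟨F, rfl⟩ := exists_node t
    exact ⟨ofForest K F, bplus_ofForest K F⟩
  exact h hy

/-! ### The coproduct of a grafting -/

/-- The operator commutes with `id ⊗ B₊` up to the factor `x ⊗ 1 + 1 ⊗ x`: the new root contributes
`1 ⊗ x` through `D` and `x ⊗ 1` through `E`. For primitive `x` this factor is `Δ(x)`, which makes
the induction of `comul_graftDer` close. -/
theorem tensorDer_map_bplus (x : HCK K) (z : HCK K ⊗[K] HCK K) :
    tensorDer (graftDer x) (degreeDer K) x (TensorProduct.map LinearMap.id (bplus K) z) =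
      TensorProduct.map LinearMap.id (bplus K)
        (z * (x ⊗ₜ 1 + 1 ⊗ₜ x) + tensorDer (graftDer x) (degreeDer K) x z) := by
  induction z with
  | zero => simp
  | add u v hu hv => simp only [map_add, hu, hv, add_mul]; abel
  | tmul a b =>
    simp only [TensorProduct.map_tmul, LinearMap.id_apply, tensorDer_tmul, graftDer_bplus,
      degreeDer_bplus, mul_add, Algebra.TensorProduct.tmul_mul_tmul, mul_one, map_add,
      TensorProduct.tmul_add, mul_comm x a]
    abel

theorem comul_graftDer {x : HCK K} (hx : IsPrimitive x) (g : HCK K) :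
    comul K (graftDer x g) = tensorDer (graftDer x) (degreeDer K) x (comul K g) := by
  -- Both sides obey the same Leibniz rule along the morphism `Δ`, so the identity passes from trees
  -- to forests.
  have hforest : ∀ F : Forest, (∀ t ∈ F, comul K (graftDer x (tree K t)) =
        tensorDer (graftDer x) (degreeDer K) x (comul K (tree K t))) →
      comul K (graftDer x (ofForest K F)) =
        tensorDer (graftDer x) (degreeDer K) x (comul K (ofForest K F)) := by
    intro F hF
    induction F using Multiset.induction_on with
    | empty => simp [ofForest_zero, Algebra.TensorProduct.one_def, tensorDer_tmul]
    | cons a F ih =>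
      rw [ofForest_cons, Derivation.leibniz, map_mul, tensorDer_mul, map_add, smul_eq_mul,
        smul_eq_mul, map_mul, map_mul, hF a (Multiset.mem_cons_self a F),
        ih fun t ht => hF t (Multiset.mem_cons_of_mem ht)]
      ring
  have htree : ∀ t, comul K (graftDer x (tree K t)) =
        tensorDer (graftDer x) (degreeDer K) x (comul K (tree K t)) := by
    intro t
    induction t using RTree.induct with
    | h F ih =>
      have hF := hforest F ih
      rw [← bplus_ofForest, graftDer_bplus, comul_bplus, comul_bplus, map_add (comul K), map_mul,
        hF, hx, map_add (tensorDer _ _ _), tensorDer_map_bplus, tensorDer_tmul, graftDer_bplus]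
      simp
  induction g using induction_ofForest with
  | h F => exact hforest F fun t _ => htree t
  | hadd y z hy hz => simp only [map_add, hy, hz]
  | hsmul c y hy => simp only [map_smul, Derivation.map_smul, hy]

/-- The counit. -/
def counit (K : Type*) [Field K] : HCK K →ₐ[K] K := MvPolynomial.aeval (fun _ => 0)

theorem counit_tree (t : RTree) : counit K (tree K t) = 0 := MvPolynomial.aeval_X _ _

/-- The left counit axiom, again by the cocycle identity. It later evaluates the term of `λ` coming
from `X ⊗ E`. -/
theorem counit_comul (g : HCK K) :
    Algebra.TensorProduct.lid K (HCK K)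
      (Algebra.TensorProduct.map (counit K) (AlgHom.id K (HCK K)) (comul K g)) = g := by
  let f : HCK K →ₐ[K] HCK K := ((Algebra.TensorProduct.lid K (HCK K)).toAlgHom.comp
      (Algebra.TensorProduct.map (counit K) (AlgHom.id K (HCK K)))).comp (comul K)
  suffices h : f = AlgHom.id K _ from AlgHom.congr_fun h g
  refine MvPolynomial.algHom_ext fun t => ?_
  change f (tree K t) = tree K t
  induction t using RTree.induct with
  | h F ih =>
    have hF : f (ofForest K F) = ofForest K F := by
      rw [ofForest, map_multiset_prod, Multiset.map_map]
      exact congrArg _ (Multiset.map_congr rfl ih)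
    have hb : ∀ z : HCK K ⊗[K] HCK K, Algebra.TensorProduct.lid K (HCK K)
        (Algebra.TensorProduct.map (counit K) (AlgHom.id K (HCK K))
          (TensorProduct.map LinearMap.id (bplus K) z)) =
        bplus K (Algebra.TensorProduct.lid K (HCK K)
          (Algebra.TensorProduct.map (counit K) (AlgHom.id K (HCK K)) z)) := by
      intro z
      induction z with
      | zero => simp
      | add u v hu hv => simp only [map_add, hu, hv]
      | tmul a b => simp
    change Algebra.TensorProduct.lid K (HCK K) (Algebra.TensorProduct.map (counit K)
      (AlgHom.id K (HCK K)) (comul K (tree K (node F)))) = _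
    rw [← bplus_ofForest, comul_bplus, map_add, map_add, hb,
      Algebra.TensorProduct.map_tmul, bplus_ofForest, counit_tree, zero_tmul, map_zero, zero_add,
      ← bplus_ofForest]
    exact congrArg _ hF

/-! ### Grafting preserves nonzero combinations of trees -/

theorem totalDegree_ofForest_le (F : Forest) : (ofForest K F).totalDegree ≤ F.card := by
  induction F using Multiset.induction_on with
  | empty => simp [ofForest_zero]
  | cons a F ih =>
    rw [ofForest_cons, Multiset.card_cons, add_comm]
    exact (MvPolynomial.totalDegree_mul _ _).trans
      (add_le_add (MvPolynomial.totalDegree_X a).le ih)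

/-- The total degree counts the trees of a forest, and grafting on a vertex leaves their number
unchanged. -/
theorem totalDegree_graftDer_le (x g : HCK K) : (graftDer x g).totalDegree ≤ g.totalDegree := by
  classical
  have h : ∀ (F G : Forest), (preLie K (ofForest K F) (ofForest K G)) ∈
      MvPolynomial.restrictTotalDegree RTree K F.card := by
    intro F G
    rw [preLie_ofForest]
    refine multiset_sum_mem _ fun y hy => ?_
    obtain ⟨H, hH, rfl⟩ := Multiset.mem_map.1 hy
    rw [graftForest, Multiset.mem_bind] at hH
    obtain ⟨t, ht, hH⟩ := hH
    obtain ⟨u, _, rfl⟩ := Multiset.mem_map.1 hH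
    rw [MvPolynomial.mem_restrictTotalDegree]
    refine (totalDegree_ofForest_le _).trans_eq ?_
    obtain ⟨F', rfl⟩ := Multiset.exists_cons_of_mem ht
    rw [Multiset.card_cons, Multiset.erase_cons_head, Multiset.card_cons]
  have h' : ∀ (F : Forest) (x : HCK K), preLie K (ofForest K F) x ∈
      MvPolynomial.restrictTotalDegree RTree K F.card := by
    intro F x
    induction x using induction_ofForest with
    | h G => exact h F G
    | hadd y z hy hz => rw [map_add]; exact add_mem hy hz
    | hsmul c y hy => rw [map_smul]; exact Submodule.smul_mem _ c hy
  rw [← MvPolynomial.mem_restrictTotalDegree, g.as_sum, map_sum]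
  refine Submodule.sum_mem _ fun m hm => ?_
  rw [← mul_one (g.coeff m), ← smul_eq_mul, ← MvPolynomial.smul_monomial, Derivation.map_smul,
    ← ofForest_toMultiset, graftDer_eq_preLie]
  refine Submodule.smul_mem _ _ ?_
  have := h' (Finsupp.toMultiset m) x
  rw [MvPolynomial.mem_restrictTotalDegree] at this ⊢
  refine this.trans ?_
  rw [Finsupp.card_toMultiset, ← g.as_sum]
  exact MvPolynomial.le_totalDegree hm

/-- With `y = B₊(g)`, the product is `B₊(g x + D g)`. Here `g x` has strictly more trees in top
degree than `g`, whereas `D g` has no more than `g`, so they cannot cancel; and `B₊` is injective.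
-/
theorem preLie_ne_zero {s : Set RTree} {x y : HCK K}
    (hy : y ∈ Submodule.span K (tree K '' s)) (hy0 : y ≠ 0) (hx : x.totalDegree ≠ 0) :
    preLie K y x ≠ 0 := by
  obtain ⟨g, rfl⟩ := exists_bplus_of_mem_span hy
  have hg : g ≠ 0 := fun h => hy0 (by rw [h, map_zero])
  have hx0 : x ≠ 0 := fun h => hx (by rw [h, MvPolynomial.totalDegree_zero])
  rw [← graftDer_eq_preLie, graftDer_bplus, Ne, map_eq_zero_iff _ bplus_injective]
  intro h
  have h1 := MvPolynomial.totalDegree_mul_of_isDomain hg hx0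
  rw [eq_neg_of_add_eq_zero_left h, MvPolynomial.totalDegree_neg] at h1
  have h2 := totalDegree_graftDer_le x g
  omega

theorem isWeightedHomogeneous_ofForest (F : Forest) :
    MvPolynomial.IsWeightedHomogeneous size (ofForest K F) (F.map size).sum := by
  induction F using Multiset.induction_on with
  | empty => simpa [ofForest_zero] using MvPolynomial.isWeightedHomogeneous_one K size
  | cons a F ih =>
    rw [ofForest_cons, Multiset.map_cons, Multiset.sum_cons]
    exact (MvPolynomial.isWeightedHomogeneous_X K size a).mul ih

theorem IsHomogeneousOfDegree.totalDegree_ne_zero {n : ℕ} (hn : n ≠ 0) {x : HCK K} (hx0 : x ≠ 0)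
    (hx : IsHomogeneousOfDegree n x) : x.totalDegree ≠ 0 := by
  intro h
  rw [MvPolynomial.totalDegree_eq_zero_iff_eq_C] at h
  have h0 := MvPolynomial.isWeightedHomogeneous_C (σ := RTree) size (x.coeff 0)
  rw [← h] at h0
  exact hn (MvPolynomial.IsWeightedHomogeneous.inj_right hx0 hx h0)

theorem preLie_mem_span {n N : ℕ} {x y : HCK K}
    (hy : y ∈ Submodule.span K (tree K '' {t | size t = n})) (hx : IsHomogeneousOfDegree N x) :
    preLie K y x ∈ Submodule.span K (tree K '' {t | size t = n + N}) := by
  classical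
  induction hy using Submodule.span_induction with
  | zero => simp
  | add y z _ _ hy hz => rw [map_add]; exact add_mem hy hz
  | smul c y _ hy => rw [map_smul]; exact Submodule.smul_mem _ c hy
  | mem y hy =>
    obtain ⟨t, ht, rfl⟩ := hy
    rw [x.as_sum, map_sum]
    refine Submodule.sum_mem _ fun m hm => ?_
    have hm' := hx (MvPolynomial.mem_support_iff.1 hm)
    have hsize : ((Finsupp.toMultiset m).map size).sum = N := by
      have h := isWeightedHomogeneous_ofForest (K := K) (Finsupp.toMultiset m)
      rw [ofForest_toMultiset] at h
      rw [← hm', h (d := m) (by rw [MvPolynomial.coeff_monomial, if_pos rfl]; exact one_ne_zero)]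
    rw [← mul_one (x.coeff m), ← smul_eq_mul, ← MvPolynomial.smul_monomial, map_smul,
      ← ofForest_toMultiset, preLie_tree_ofForest]
    refine Submodule.smul_mem _ _ (multiset_sum_mem _ fun z hz => ?_)
    obtain ⟨u, hu, rfl⟩ := Multiset.mem_map.1 hz
    refine Submodule.subset_span ⟨u, ?_, rfl⟩
    rw [Set.mem_ofPred_eq, size_of_mem_graft _ _ u hu, hsize, ht]

theorem IsNonzeroTreeComb.preLie {n N : ℕ} (hN : N ≠ 0) {x y : HCK K}
    (hy : IsNonzeroTreeComb n y) (hx0 : x ≠ 0) (hx : IsHomogeneousOfDegree N x) :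
    IsNonzeroTreeComb (n + N) (preLie K y x) :=
  ⟨preLie_ne_zero hy.2 hy.1 (hx.totalDegree_ne_zero hN hx0), preLie_mem_span hy.2 hx⟩

end HCK

/-! ### Linear coefficients in the polynomial ring on the generators. -/

section Polynomials

open MvPolynomial

variable {K : Type*} [Field K] {σ τ : Type*}

theorem MvPolynomial.IsWeightedHomogeneous.aeval {w : σ → ℕ} {w' : τ → ℕ}
    {f : σ → MvPolynomial τ K} (hf : ∀ i, IsWeightedHomogeneous w' (f i) (w i))
    {p : MvPolynomial σ K} {n : ℕ} (hp : IsWeightedHomogeneous w p n) :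
    IsWeightedHomogeneous w' (MvPolynomial.aeval f p) n := by
  induction hp using MvPolynomial.IsWeightedHomogeneous.induction_on with
  | zero => simpa using isWeightedHomogeneous_zero K w' n
  | add p q _ _ hp hq => rw [map_add]; exact hp.add hq
  | monomial d r hr =>
    rw [aeval_monomial, MvPolynomial.algebraMap_eq]
    refine IsWeightedHomogeneous.C_mul ?_ r
    rw [← hr, Finsupp.weight_apply, Finsupp.sum]
    exact IsWeightedHomogeneous.prod _ _ _ fun i _ => (hf i).pow _

theorem MvPolynomial.coeff_single_one_mul (i : σ) (p q : MvPolynomial σ K) :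
    coeff (Finsupp.single i 1) (p * q) =
      constantCoeff p * coeff (Finsupp.single i 1) q +
        coeff (Finsupp.single i 1) p * constantCoeff q := by
  classical
  rw [coeff_mul, Finsupp.antidiagonal_single]
  simp [Finset.Nat.antidiagonal_succ, constantCoeff_eq]

/-- The derivation of `K[X_1, X_2, …]` sending `X_n` to `X_{n+N}`. -/
def shiftDer (K : Type*) [Field K] (N : ℕ+) :
    Derivation K (MvPolynomial ℕ+ K) (MvPolynomial ℕ+ K) :=
  mkDerivation K (fun n => X (n + N))

/-- The derivation of `K[X_1, X_2, …]` sending `X_n` to `n X_n`. -/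
def weightDer (K : Type*) [Field K] :
    Derivation K (MvPolynomial ℕ+ K) (MvPolynomial ℕ+ K) :=
  mkDerivation K (fun n => ((n : ℕ) : K) • X n)

theorem MvPolynomial.constantCoeff_derivation
    {D : Derivation K (MvPolynomial σ K) (MvPolynomial σ K)}
    (h : ∀ i, constantCoeff (D (X i)) = 0) (p : MvPolynomial σ K) : constantCoeff (D p) = 0 := by
  induction p using MvPolynomial.induction_on with
  | C a => simp
  | add p q hp hq => simp [hp, hq]
  | mul_X p i hp => simp [Derivation.leibniz, h, hp]

/-- Such a `D` preserves the ideal of polynomials without constant term, so `X i * D p` has no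
linear part. -/
theorem MvPolynomial.coeff_single_one_derivation_mul_X
    {D : Derivation K (MvPolynomial σ K) (MvPolynomial σ K)}
    (h : ∀ i, constantCoeff (D (X i)) = 0) (p : MvPolynomial σ K) (i j : σ) :
    coeff (Finsupp.single j 1) (D (p * X i)) =
      constantCoeff p * coeff (Finsupp.single j 1) (D (X i)) := by
  rw [Derivation.leibniz, coeff_add, smul_eq_mul, smul_eq_mul, coeff_single_one_mul,
    coeff_single_one_mul, h, constantCoeff_derivation h, constantCoeff_X]
  ring

theorem shiftDer_X (N n : ℕ+) : shiftDer K N (X n) = X (n + N) := mkDerivation_X _ _ _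

theorem weightDer_X (n : ℕ+) : weightDer K (X n) = ((n : ℕ) : K) • X n := mkDerivation_X _ _ _

/-- Together with `coeff_shiftDer_of_le`, this gives the transpose of the shift on linear forms:
index `l` goes to `l - N`, or to zero if `l ≤ N`. The convention on nonpositive indices of `λ` comes
from here. -/
theorem coeff_shiftDer_add (N l : ℕ+) (p : MvPolynomial ℕ+ K) :
    coeff (Finsupp.single (l + N) 1) (shiftDer K N p) = coeff (Finsupp.single l 1) p := by
  classical
  induction p using MvPolynomial.induction_on with
  | C a => simp [coeff_C, eq_comm (a := (0 : ℕ+ →₀ ℕ))]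
  | add p q hp hq => simp [hp, hq]
  | mul_X p i hp =>
    rw [coeff_single_one_derivation_mul_X (fun i => by simp [shiftDer_X]), coeff_single_one_mul,
      shiftDer_X, constantCoeff_X, coeff_X, coeff_X]
    simp [Finsupp.single_left_inj]

theorem coeff_shiftDer_of_le {N l : ℕ+} (hl : l ≤ N) (p : MvPolynomial ℕ+ K) :
    coeff (Finsupp.single l 1) (shiftDer K N p) = 0 := by
  classical
  induction p using MvPolynomial.induction_on with
  | C a => simp
  | add p q hp hq => simp [hp, hq]
  | mul_X p i hp =>
    have hne : i + N ≠ l := fun h => by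
      rw [← h] at hl
      exact absurd (PNat.lt_add_left N i) (not_lt.2 hl)
    rw [coeff_single_one_derivation_mul_X (fun i => by simp [shiftDer_X]), shiftDer_X, coeff_X]
    simp [Finsupp.single_left_inj, hne]

theorem coeff_weightDer (l : ℕ+) (p : MvPolynomial ℕ+ K) :
    coeff (Finsupp.single l 1) (weightDer K p) =
      ((l : ℕ) : K) * coeff (Finsupp.single l 1) p := by
  classical
  induction p using MvPolynomial.induction_on with
  | C a => simp [coeff_C, eq_comm (a := (0 : ℕ+ →₀ ℕ))]
  | add p q hp hq => simp [hp, hq, mul_add]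
  | mul_X p i hp =>
    rw [coeff_single_one_derivation_mul_X (fun i => by simp [weightDer_X]), coeff_single_one_mul,
      weightDer_X, constantCoeff_X, coeff_smul, coeff_X, smul_eq_mul]
    by_cases h : i = l
    · subst h; simp; ring
    · simp [Finsupp.single_left_inj, h]

/-- The bilinear extension `a ⊗ b ↦ f a * g b` of two linear forms. -/
def tensorForm {R : Type*} [AddCommMonoid R] [Module K R] (f g : R →ₗ[K] K) : R ⊗[K] R →ₗ[K] K :=
  LinearMap.mul' K K ∘ₗ TensorProduct.map f g

theorem tensorForm_tmul {R : Type*} [AddCommMonoid R] [Module K R] (f g : R →ₗ[K] K) (a b : R) :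
    tensorForm f g (a ⊗ₜ b) = f a * g b := rfl

/-- The coefficient of `X_i`. -/
def linCoeff (K : Type*) [Field K] (i : σ) : MvPolynomial σ K →ₗ[K] K :=
  lcoeff K (Finsupp.single i 1)

theorem linCoeff_apply (i : σ) (p : MvPolynomial σ K) :
    linCoeff K i p = coeff (Finsupp.single i 1) p := rfl

theorem basisMonomials_tensorProduct_repr (Q : MvPolynomial σ K ⊗[K] MvPolynomial σ K) (i j : σ) :
    ((basisMonomials σ K).tensorProduct (basisMonomials σ K)).repr Q
      (Finsupp.single i 1, Finsupp.single j 1) =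
      tensorForm (linCoeff K i) (linCoeff K j) Q := by
  induction Q with
  | zero => simp
  | add p q hp hq => rw [map_add, Finsupp.add_apply, hp, hq, map_add]
  | tmul p q =>
    rw [Module.Basis.tensorProduct_repr_tmul_apply, tensorForm_tmul, smul_eq_mul, mul_comm]
    rfl

/-- The linear form of the constant coefficients. -/
def constForm (K : Type*) [Field K] (σ : Type*) : MvPolynomial σ K →ₗ[K] K :=
  lcoeff K 0

theorem constForm_apply (p : MvPolynomial σ K) : constForm K σ p = constantCoeff p := rfl

/-- Since `P` has no constant term, the linear part of `P * a` sees only the constant term of `a`;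
the factor `k` is the eigenvalue of `weightDer`. -/
theorem tensorForm_tensorDer (N k l : ℕ+) {P : MvPolynomial ℕ+ K} (hP : constantCoeff P = 0)
    (Q : MvPolynomial ℕ+ K ⊗[K] MvPolynomial ℕ+ K) :
    tensorForm (linCoeff K l) (linCoeff K k)
        (tensorDer (shiftDer K N) (weightDer K) P Q) =
      tensorForm (linCoeff K l ∘ₗ (shiftDer K N : MvPolynomial ℕ+ K →ₗ[K] _)) (linCoeff K k) Q +
      tensorForm (linCoeff K l) (linCoeff K k ∘ₗ (shiftDer K N : MvPolynomial ℕ+ K →ₗ[K] _)) Q +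
      linCoeff K l P * ((k : ℕ) : K) * tensorForm (constForm K ℕ+) (linCoeff K k) Q := by
  induction Q with
  | zero => simp
  | add p q hp hq => simp only [map_add, hp, hq]; ring
  | tmul p q =>
    simp only [tensorDer_tmul, map_add, tensorForm_tmul, LinearMap.comp_apply,
      Derivation.coeFn_coe, constForm_apply]
    simp only [linCoeff_apply, coeff_weightDer, coeff_single_one_mul, hP]
    ring

end Polynomials

/-! ### Transporting ranges and derivations along algebra morphisms. -/

section RangeMap

variable {K A B C : Type*} [CommRing K] [CommRing A] [CommRing B] [CommRing C] [Algebra K A]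
  [Algebra K B] [Algebra K C]

theorem Algebra.TensorProduct.range_map_le {f : A →ₐ[K] C} {g : B →ₐ[K] C}
    (h : f.range ≤ g.range) :
    (Algebra.TensorProduct.map f f).range ≤ (Algebra.TensorProduct.map g g).range := by
  rw [Algebra.TensorProduct.map_range, Algebra.TensorProduct.map_range, AlgHom.range_comp,
    AlgHom.range_comp, AlgHom.range_comp, AlgHom.range_comp]
  exact sup_le_sup (Subalgebra.map_mono h) (Subalgebra.map_mono h)

theorem Algebra.TensorProduct.range_map_congr {f : A →ₐ[K] C} {g : B →ₐ[K] C}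
    (h : f.range = g.range) :
    (Algebra.TensorProduct.map f f).range = (Algebra.TensorProduct.map g g).range :=
  le_antisymm (range_map_le h.le) (range_map_le h.ge)

theorem tensorDer_map {D E : Derivation K A A} {D' E' : Derivation K C C} {f : A →ₐ[K] C}
    (hD : ∀ a, D' (f a) = f (D a)) (hE : ∀ a, E' (f a) = f (E a)) (x : A) (z : A ⊗[K] A) :
    tensorDer D' E' (f x) (Algebra.TensorProduct.map f f z) =
      Algebra.TensorProduct.map f f (tensorDer D E x z) := by
  induction z with
  | zero => simp
  | add u v hu hv => simp only [map_add, hu, hv]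
  | tmul a b => simp [tensorDer_tmul, hD, hE]

theorem derivation_aeval {σ : Type*} {D : Derivation K (MvPolynomial σ K) (MvPolynomial σ K)}
    {D' : Derivation K C C} {t : σ → C}
    (h : ∀ i, D' (t i) = MvPolynomial.aeval t (D (MvPolynomial.X i))) (p : MvPolynomial σ K) :
    D' (MvPolynomial.aeval t p) = MvPolynomial.aeval t (D p) := by
  induction p using MvPolynomial.induction_on with
  | C a => simp
  | add p q hp hq => simp [hp, hq]
  | mul_X p i hp => simp [Derivation.leibniz, h, hp]

end RangeMap

namespace HCK

open RTree TensorProduct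

variable {K : Type*} [Field K]

theorem isHomogeneousOfDegree_of_mem_span {n : ℕ} {y : HCK K}
    (hy : y ∈ Submodule.span K (tree K '' {t | size t = n})) : IsHomogeneousOfDegree n y := by
  have h : Submodule.span K (tree K '' {t | size t = n}) ≤
      MvPolynomial.weightedHomogeneousSubmodule K size n := by
    rw [Submodule.span_le]
    rintro _ ⟨t, rfl, rfl⟩
    exact MvPolynomial.isWeightedHomogeneous_X K size t
  exact h hy

theorem degreeDer_of_mem_span {n : ℕ} {y : HCK K}
    (hy : y ∈ Submodule.span K (tree K '' {t | size t = n})) : degreeDer K y = (n : K) • y := by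
  induction hy using Submodule.span_induction with
  | zero => simp
  | add y z _ _ hy hz => rw [map_add, hy, hz, smul_add]
  | smul c y _ hy => rw [Derivation.map_smul, hy, smul_comm]
  | mem y hy => obtain ⟨t, rfl, rfl⟩ := hy; exact degreeDer_tree t

/-! ### The antipode -/

/-- The projection on the degrees smaller than `n`. -/
def truncate (K : Type*) [Field K] (n : ℕ) : HCK K →ₗ[K] HCK K :=
  ∑ d ∈ Finset.range n, MvPolynomial.weightedHomogeneousComponent size d

theorem truncate_of_lt {n d : ℕ} (h : d < n) {x : HCK K} (hx : IsHomogeneousOfDegree d x) :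
    truncate K n x = x := by
  rw [truncate, LinearMap.sum_apply, Finset.sum_eq_single_of_mem d (Finset.mem_range.2 h)]
  · exact hx.weightedHomogeneousComponent_same
  · exact fun e _ he => hx.weightedHomogeneousComponent_ne e he

theorem truncate_of_le {n d : ℕ} (h : n ≤ d) {x : HCK K} (hx : IsHomogeneousOfDegree d x) :
    truncate K n x = 0 := by
  rw [truncate, LinearMap.sum_apply]
  refine Finset.sum_eq_zero fun e he => hx.weightedHomogeneousComponent_ne e ?_
  have := Finset.mem_range.1 he
  omega

/-- The recursive formula for the antipode, expressed through `Δ`. The truncation changes nothing,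
since the part containing the root is nonempty and so `P^c(t)` has degree below `n`. It matters when
`Δ(y)` is decomposed otherwise than by cuts: the antipode is still applied only in degrees below
`n`. -/
theorem antipode_of_mem_span {n : ℕ} {y : HCK K}
    (hy : y ∈ Submodule.span K (tree K '' {t | size t = n})) :
    antipode K y = -LinearMap.mul' K (HCK K)
      (TensorProduct.map ((antipode K).toLinearMap ∘ₗ truncate K n) LinearMap.id
        (comul K y - y ⊗ₜ 1)) := by
  induction hy using Submodule.span_induction with
  | zero => simp
  | add y z _ _ hy hz => rw [map_add, hy, hz]; simp only [map_add, map_sub, add_tmul]; abel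
  | smul c y _ hy =>
    simp only [map_smul, hy, ← smul_tmul', map_sub, smul_sub, smul_neg]
  | mem y hy =>
    obtain ⟨t, rfl, rfl⟩ := hy
    have h : comul K (tree K t) - tree K t ⊗ₜ 1 =
        ((cuts t).map (fun c => ofForest K c.1 ⊗ₜ[K] tree K c.2)).sum :=
      sub_eq_of_eq_add' (MvPolynomial.aeval_X _ _)
    rw [h, antipode_tree, map_multiset_sum, map_multiset_sum, Multiset.map_map, Multiset.map_map]
    congr 2
    refine Multiset.map_congr rfl fun c hc => ?_
    have h1 := size_add_of_mem_cuts t c hc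
    have h2 := size_pos c.2
    simp only [Function.comp_apply, TensorProduct.map_tmul, LinearMap.comp_apply,
      LinearMap.mul'_apply, LinearMap.id_apply, AlgHom.toLinearMap_apply]
    rw [truncate_of_lt (by omega) (isWeightedHomogeneous_ofForest c.1)]

theorem isHopfSubalgebra_adjoin {t : ℕ+ → HCK K}
    (ht : ∀ n : ℕ+, t n ∈ Submodule.span K (tree K '' {u | size u = n}))
    (hcomul : ∀ n, comul K (t n) ∈
      (Algebra.TensorProduct.map (MvPolynomial.aeval (R := K) t) (MvPolynomial.aeval t)).range) :
    IsHopfSubalgebra (Algebra.adjoin K (Set.range t)) := by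
  set A := Algebra.adjoin K (Set.range t) with hA
  have hrange : A.val.range = (MvPolynomial.aeval (R := K) t).range := by
    rw [Subalgebra.range_val, hA, Algebra.adjoin_range_eq_range_aeval]
  have hcomul' : ∀ a ∈ A, comul K a ∈ (Algebra.TensorProduct.map A.val A.val).range := by
    have h : A ≤ (Algebra.TensorProduct.map A.val A.val).range.comap (comul K) := by
      rw [hA, Algebra.adjoin_le_iff]
      rintro _ ⟨n, rfl⟩
      rw [SetLike.mem_coe, Subalgebra.mem_comap, Algebra.TensorProduct.range_map_congr hrange]
      exact hcomul n
    exact fun a ha => h ha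
  have hanti : ∀ n : ℕ, ∀ i : ℕ+, (i : ℕ) = n → antipode K (t i) ∈ A := by
    intro n
    induction n using Nat.strong_induction_on with
    | _ n ih =>
      intro i hi
      -- Monomials in the `t_j` are homogeneous, so truncation keeps or kills each one; those kept
      -- involve only `t_j` with `j < n`, covered by the induction hypothesis.
      have htrunc : ∀ a ∈ A, antipode K (truncate K n a) ∈ A := by
        intro a ha
        rw [hA, Algebra.adjoin_range_eq_range_aeval] at ha
        obtain ⟨p, rfl⟩ := ha
        change antipode K (truncate K n (MvPolynomial.aeval t p)) ∈ A
        induction p using MvPolynomial.induction_on' with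
        | add p q hp hq => simp only [map_add]; exact add_mem hp hq
        | monomial m c =>
          have hm : IsHomogeneousOfDegree _ (MvPolynomial.aeval t (MvPolynomial.monomial m c)) :=
            (MvPolynomial.isWeightedHomogeneous_monomial (fun n : ℕ+ => (n : ℕ)) m c rfl).aeval
              fun i => isHomogeneousOfDegree_of_mem_span (ht i)
          rcases lt_or_ge (Finsupp.weight (fun n : ℕ+ => (n : ℕ)) m) n with hlt | hle
          · rw [truncate_of_lt hlt hm, MvPolynomial.aeval_monomial, map_mul, AlgHom.commutes,
              map_finsuppProd]
            refine mul_mem (A.algebraMap_mem c) (prod_mem fun j hj => ?_)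
            simp only [map_pow]
            refine pow_mem (ih j ?_ j rfl) _
            exact (Finsupp.le_weight_of_ne_zero' (fun n : ℕ+ => (n : ℕ))
              (Finsupp.mem_support_iff.1 hj)).trans_lt hlt
          · rw [truncate_of_le hle hm, map_zero]
            exact zero_mem A
      have hmem : comul K (t i) - t i ⊗ₜ 1 ∈ (Algebra.TensorProduct.map A.val A.val).range := by
        have hti : t i ∈ A := Algebra.subset_adjoin ⟨i, rfl⟩
        exact sub_mem (hcomul' _ hti) ⟨⟨t i, hti⟩ ⊗ₜ 1, by simp⟩
      obtain ⟨z, hz⟩ := hmem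
      rw [antipode_of_mem_span (n := n) (hi ▸ ht i), ← hz]
      refine neg_mem ?_
      clear hz
      change LinearMap.mul' K (HCK K) (TensorProduct.map _ _
        (Algebra.TensorProduct.map A.val A.val z)) ∈ A
      induction z with
      | zero => simp
      | add u v hu hv => simp only [map_add]; exact add_mem hu hv
      | tmul a b => exact mul_mem (htrunc a a.2) b.2
  refine ⟨hcomul', fun a ha => ?_⟩
  have h : A ≤ A.comap (antipode K) := by
    conv_lhs => rw [hA]
    rw [Algebra.adjoin_le_iff]
    rintro _ ⟨n, rfl⟩
    exact hanti n n rfl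
  exact h ha

/-! ### Writing elements as polynomials in the generators -/

theorem exists_size_eq_coeff_ne_zero {n : ℕ} {y : HCK K} (hy : IsNonzeroTreeComb n y) :
    ∃ u, size u = n ∧ MvPolynomial.coeff (Finsupp.single u 1) y ≠ 0 := by
  classical
  have h : ∀ m, MvPolynomial.coeff m y ≠ 0 → ∃ u, size u = n ∧ m = Finsupp.single u 1 := by
    obtain ⟨-, hy⟩ := hy
    induction hy using Submodule.span_induction with
    | zero => simp
    | add y z _ _ hy hz =>
      intro m hm
      by_cases h0 : MvPolynomial.coeff m y = 0
      · exact hz m fun h => hm (by rw [MvPolynomial.coeff_add, h0, h, add_zero])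
      · exact hy m h0
    | smul c y _ hy => exact fun m hm => hy m fun h => hm (by simp [h])
    | mem y hy =>
      obtain ⟨u, hu, rfl⟩ := hy
      intro m hm
      rw [tree, MvPolynomial.coeff_X] at hm
      exact ⟨u, hu, by_contra fun h => hm (if_neg fun h' => h h'.symm)⟩
  obtain ⟨m, hm⟩ := MvPolynomial.ne_zero_iff.1 hy.1
  obtain ⟨u, hu, rfl⟩ := h m hm
  exact ⟨u, hu, hm⟩

/-- Algebraic independence of the `t_n`, by a graded left inverse: a tree `T n` is picked in the
support of each `t_n` and sent to a multiple of `X_n`, all other trees being sent to `0`. -/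
theorem exists_leftInverse_aeval {t : ℕ+ → HCK K} (ht : ∀ n : ℕ+, IsNonzeroTreeComb n (t n)) :
    ∃ v : RTree → MvPolynomial ℕ+ K,
      (∀ u, MvPolynomial.IsWeightedHomogeneous (fun n : ℕ+ => (n : ℕ)) (v u) (size u)) ∧
      ∀ p, MvPolynomial.aeval v (MvPolynomial.aeval t p) = p := by
  classical
  choose T hT hc using fun n => exists_size_eq_coeff_ne_zero (ht n)
  let s : RTree → ℕ+ := fun u => ⟨size u, size_pos u⟩
  let c : ℕ+ → K := fun n => MvPolynomial.coeff (Finsupp.single (T n) 1) (t n)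
  let v : RTree → MvPolynomial ℕ+ K := fun u =>
    if u = T (s u) then MvPolynomial.C (c (s u))⁻¹ * MvPolynomial.X (s u) else 0
  refine ⟨v, fun u => ?_, fun p => ?_⟩
  · by_cases h : u = T (s u)
    · simp only [v, if_pos h]
      exact (MvPolynomial.isWeightedHomogeneous_X K (fun n : ℕ+ => (n : ℕ)) (s u)).C_mul _
    · simp only [v, if_neg h]
      exact MvPolynomial.isWeightedHomogeneous_zero K _ _
  · have key : ∀ (n : ℕ+) (y : HCK K), y ∈ Submodule.span K (tree K '' {u | size u = n}) →
        MvPolynomial.aeval v y = MvPolynomial.C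
          (MvPolynomial.coeff (Finsupp.single (T n) 1) y * (c n)⁻¹) * MvPolynomial.X n := by
      intro n y hy
      induction hy using Submodule.span_induction with
      | zero => simp
      | add y z _ _ hy hz => rw [map_add, hy, hz, MvPolynomial.coeff_add]; simp; ring
      | smul a y _ hy =>
        rw [map_smul, hy, MvPolynomial.coeff_smul, MvPolynomial.smul_eq_C_mul]; simp; ring
      | mem y hy =>
        obtain ⟨u, hu, rfl⟩ := hy
        have hs : s u = n := PNat.eq hu
        rw [tree, MvPolynomial.aeval_X, MvPolynomial.coeff_X]
        simp only [v, hs, Finsupp.single_left_inj one_ne_zero]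
        split_ifs <;> simp
    have h : (MvPolynomial.aeval v).comp (MvPolynomial.aeval t) = AlgHom.id K _ :=
      MvPolynomial.algHom_ext fun n => by
        rw [AlgHom.comp_apply, MvPolynomial.aeval_X, key n _ (ht n).2]
        simp [c, hc n]
    exact AlgHom.congr_fun h p

end HCK

theorem extendByZero_coe {K : Type*} [Zero K] (lam : ℕ+ → ℕ+ → K) (i j : ℕ+) :
    extendByZero lam (i : ℕ) (j : ℕ) = lam i j := by
  rw [extendByZero, if_pos ⟨by exact_mod_cast i.pos, by exact_mod_cast j.pos⟩]
  simp

theorem extendByZero_of_left_nonpos {K : Type*} [Zero K] (lam : ℕ+ → ℕ+ → K) {i : ℤ} (hi : i ≤ 0)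
    (j : ℤ) : extendByZero lam i j = 0 :=
  if_neg fun h => absurd h.1 (not_lt.2 hi)

theorem extendByZero_of_right_nonpos {K : Type*} [Zero K] (lam : ℕ+ → ℕ+ → K) (i : ℤ) {j : ℤ}
    (hj : j ≤ 0) : extendByZero lam i j = 0 :=
  if_neg fun h => absurd h.2 (not_lt.2 hj)

theorem PNat.exists_coe_eq_of_pos {k : ℤ} (hk : 0 < k) : ∃ n : ℕ+, ((n : ℕ) : ℤ) = k :=
  ⟨⟨k.toNat, by omega⟩, Int.toNat_of_nonneg hk.le⟩

namespace HCK

open RTree TensorProduct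

variable {K : Type*} [Field K]

theorem extendSeq_of_le {N : ℕ+} (t' : {n : ℕ+ // n ≤ N} → HCK K) (X : HCK K) {n : ℕ+}
    (h : n ≤ N) : extendSeq N t' X n = t' ⟨n, h⟩ := by
  rw [extendSeq, dif_pos h]

theorem extendSeq_add {N : ℕ+} (t' : {n : ℕ+ // n ≤ N} → HCK K) (X : HCK K) (n : ℕ+) :
    extendSeq N t' X (n + N) = preLie K (extendSeq N t' X n) X := by
  rw [extendSeq, dif_neg (not_le.2 (PNat.lt_add_left N n)), PNat.add_sub]

theorem adjoin_le_adjoin_extendSeq {N : ℕ+} (t' : {n : ℕ+ // n ≤ N} → HCK K) (X : HCK K) :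
    Algebra.adjoin K (Set.range t') ≤ Algebra.adjoin K (Set.range (extendSeq N t' X)) := by
  refine Algebra.adjoin_mono ?_
  rintro _ ⟨⟨n, hn⟩, rfl⟩
  exact ⟨n, extendSeq_of_le t' X hn⟩

/-- Induction for sequences given up to rank `N` and by a recursion from rank `n` to `n + N`. -/
theorem _root_.PNat.induction_add {N : ℕ+} {P : ℕ+ → Prop} (h : ∀ n ≤ N, P n)
    (hadd : ∀ n, P n → P (n + N)) (n : ℕ+) : P n := by
  induction n using PNat.strongInductionOn with
  | _ n ih =>
    rcases le_or_gt n N with hn | hn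
    · exact h n hn
    · have hn' : n - N + N = n := by rw [add_comm, PNat.add_sub_of_lt hn]
      rw [← hn']
      exact hadd _ (ih _ (hn'.le.trans_lt' (PNat.lt_add_right _ _)))

theorem isNonzeroTreeComb_extendSeq {N : ℕ+} {t' : {n : ℕ+ // n ≤ N} → HCK K}
    (h_comb : ∀ i : {n : ℕ+ // n ≤ N}, IsNonzeroTreeComb ((i : ℕ+) : ℕ) (t' i)) {X : HCK K}
    (hX_ne : X ≠ 0) (hX_deg : IsHomogeneousOfDegree (N : ℕ) X) (n : ℕ+) :
    IsNonzeroTreeComb n (extendSeq N t' X n) := by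
  induction n using PNat.induction_add (N := N) with
  | h n hn => rw [extendSeq_of_le t' X hn]; exact h_comb ⟨n, hn⟩
  | hadd n ih => rw [extendSeq_add, PNat.add_coe]; exact ih.preLie N.ne_zero hX_ne hX_deg

/-! ### Coproduct and double sequence of a sequence with `t_{n+N} = t_n • X`. -/

section ShiftedSequence

variable {N : ℕ+} {t : ℕ+ → HCK K} {X : HCK K}

theorem tensorDer_map_aeval
    (ht : ∀ n : ℕ+, t n ∈ Submodule.span K (tree K '' {u | size u = n}))
    (hshift : ∀ n, t (n + N) = preLie K (t n) X) {P : MvPolynomial ℕ+ K}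
    (hP : MvPolynomial.aeval t P = X) (Q : MvPolynomial ℕ+ K ⊗[K] MvPolynomial ℕ+ K) :
    tensorDer (graftDer X) (degreeDer K) X
        (Algebra.TensorProduct.map (MvPolynomial.aeval t) (MvPolynomial.aeval t) Q) =
      Algebra.TensorProduct.map (MvPolynomial.aeval t) (MvPolynomial.aeval t)
        (tensorDer (shiftDer K N) (weightDer K) P Q) := by
  have hD := derivation_aeval (D := shiftDer K N) (D' := graftDer X) (t := t) fun n => by
    rw [shiftDer_X, MvPolynomial.aeval_X, hshift, graftDer_eq_preLie]
  have hE := derivation_aeval (D := weightDer K) (D' := degreeDer K) (t := t) fun n => by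
    rw [weightDer_X, map_smul, MvPolynomial.aeval_X, degreeDer_of_mem_span (ht n)]
  have h := tensorDer_map hD hE P Q
  rwa [hP] at h

theorem comul_add (hX : IsPrimitive X) (hshift : ∀ n, t (n + N) = preLie K (t n) X) (n : ℕ+) :
    comul K (t (n + N)) = tensorDer (graftDer X) (degreeDer K) X (comul K (t n)) := by
  rw [hshift, ← graftDer_eq_preLie, comul_graftDer hX]

theorem comul_mem_range (ht : ∀ n : ℕ+, t n ∈ Submodule.span K (tree K '' {u | size u = n}))
    (hX : IsPrimitive X) (hX_mem : X ∈ Algebra.adjoin K (Set.range t))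
    (hshift : ∀ n, t (n + N) = preLie K (t n) X)
    (h : ∀ n ≤ N, comul K (t n) ∈
      (Algebra.TensorProduct.map (MvPolynomial.aeval (R := K) t) (MvPolynomial.aeval t)).range)
    (n : ℕ+) : comul K (t n) ∈
      (Algebra.TensorProduct.map (MvPolynomial.aeval (R := K) t) (MvPolynomial.aeval t)).range := by
  rw [Algebra.adjoin_range_eq_range_aeval] at hX_mem
  obtain ⟨P, hP⟩ := hX_mem
  induction n using PNat.induction_add (N := N) with
  | h n hn => exact h n hn
  | hadd n ih =>
    obtain ⟨Q, hQ⟩ := ih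
    rw [comul_add hX hshift, ← hQ]
    exact ⟨_, (tensorDer_map_aeval ht hshift hP Q).symm⟩

/-- The coefficient of `t_j ⊗ t_i` in `Δ(t_{i+j})`, read on a left inverse of `X_n ↦ t_n`. -/
def lambda (t : ℕ+ → HCK K) (v : RTree → MvPolynomial ℕ+ K) (i j : ℕ+) : K :=
  tensorForm (linCoeff K j) (linCoeff K i)
    (Algebra.TensorProduct.map (MvPolynomial.aeval v) (MvPolynomial.aeval v)
      (comul K (t (i + j))))

variable {v : RTree → MvPolynomial ℕ+ K}

theorem map_aeval_map_aeval (hv : ∀ p, MvPolynomial.aeval v (MvPolynomial.aeval t p) = p)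
    (Q : MvPolynomial ℕ+ K ⊗[K] MvPolynomial ℕ+ K) :
    Algebra.TensorProduct.map (MvPolynomial.aeval v) (MvPolynomial.aeval v)
      (Algebra.TensorProduct.map (MvPolynomial.aeval t) (MvPolynomial.aeval t) Q) = Q := by
  induction Q with
  | zero => simp
  | add p q hp hq => rw [map_add, map_add, hp, hq]
  | tmul p q => rw [Algebra.TensorProduct.map_tmul, Algebra.TensorProduct.map_tmul, hv, hv]

/-- Applying `v ⊗ v` to `Δ(t_n)` recovers any polynomial expression `Q` of it, so the double
sequence exists and is unique. -/
theorem isLambdaArray_iff (hv : ∀ p, MvPolynomial.aeval v (MvPolynomial.aeval t p) = p)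
    (h : ∀ n, comul K (t n) ∈
      (Algebra.TensorProduct.map (MvPolynomial.aeval (R := K) t) (MvPolynomial.aeval t)).range)
    {lam : ℕ+ → ℕ+ → K} : IsLambdaArray t lam ↔ lam = lambda t v := by
  constructor
  · intro hlam
    ext i j
    obtain ⟨Q, hQ, hc⟩ := hlam (i + j)
    rw [hc i j rfl, basisMonomials_tensorProduct_repr, lambda, ← hQ, map_aeval_map_aeval hv]
  · rintro rfl n
    obtain ⟨Q, hQ⟩ := h n
    refine ⟨Q, hQ, ?_⟩
    rintro i j rfl
    rw [basisMonomials_tensorProduct_repr, lambda, ← hQ]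
    exact congrArg _ (map_aeval_map_aeval hv Q)

/-- As the `v u` have no constant term, taking the constant coefficient after `v` is the counit, and
the counit axiom applies. -/
theorem tensorForm_const_comul
    (hv : ∀ u, MvPolynomial.constantCoeff (v u) = 0) (g : MvPolynomial ℕ+ K →ₗ[K] K) (y : HCK K) :
    tensorForm (constForm K ℕ+) g
      (Algebra.TensorProduct.map (MvPolynomial.aeval v) (MvPolynomial.aeval v) (comul K y)) =
      g (MvPolynomial.aeval v y) := by
  have hc : ∀ a : HCK K, MvPolynomial.constantCoeff (MvPolynomial.aeval v a) = counit K a := by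
    intro a
    induction a using MvPolynomial.induction_on with
    | C a => simp [counit]
    | add p q hp hq => simp only [map_add, hp, hq]
    | mul_X p u hp => simp [hv, counit]
  have h : ∀ z : HCK K ⊗[K] HCK K, tensorForm (constForm K ℕ+) g
      (Algebra.TensorProduct.map (MvPolynomial.aeval v) (MvPolynomial.aeval v) z) =
      g (MvPolynomial.aeval v (Algebra.TensorProduct.lid K (HCK K)
        (Algebra.TensorProduct.map (counit K) (AlgHom.id K (HCK K)) z))) := by
    intro z
    induction z with
    | zero => simp
    | add p q hp hq => simp only [map_add, hp, hq]
    | tmul a b =>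
      rw [Algebra.TensorProduct.map_tmul, Algebra.TensorProduct.map_tmul, tensorForm_tmul,
        constForm_apply, hc, Algebra.TensorProduct.lid_tmul, map_smul, map_smul, smul_eq_mul,
        AlgHom.id_apply]
  rw [h, counit_comul]

theorem lambda_of_add_eq (ht : ∀ n : ℕ+, t n ∈ Submodule.span K (tree K '' {u | size u = n}))
    (hX : IsPrimitive X) (hshift : ∀ n, t (n + N) = preLie K (t n) X)
    (hcomul : ∀ n, comul K (t n) ∈
      (Algebra.TensorProduct.map (MvPolynomial.aeval (R := K) t) (MvPolynomial.aeval t)).range)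
    (hX_mem : X ∈ Algebra.adjoin K (Set.range t))
    (hv : ∀ p, MvPolynomial.aeval v (MvPolynomial.aeval t p) = p)
    (hv0 : ∀ u, MvPolynomial.constantCoeff (v u) = 0)
    (hX0 : MvPolynomial.constantCoeff (MvPolynomial.aeval v X) = 0)
    {k l m : ℕ+} (hm : k + l = m + N) :
    lambda t v k l =
      tensorForm (linCoeff K l ∘ₗ (shiftDer K N : MvPolynomial ℕ+ K →ₗ[K] _)) (linCoeff K k)
        (Algebra.TensorProduct.map (MvPolynomial.aeval v) (MvPolynomial.aeval v)
          (comul K (t m))) +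
      tensorForm (linCoeff K l) (linCoeff K k ∘ₗ (shiftDer K N : MvPolynomial ℕ+ K →ₗ[K] _))
        (Algebra.TensorProduct.map (MvPolynomial.aeval v) (MvPolynomial.aeval v)
          (comul K (t m))) +
      linCoeff K l (MvPolynomial.aeval v X) * ((k : ℕ) : K) *
        linCoeff K k (MvPolynomial.X m) := by
  rw [Algebra.adjoin_range_eq_range_aeval] at hX_mem
  obtain ⟨P, hP⟩ := hX_mem
  change MvPolynomial.aeval t P = X at hP
  have hP' : MvPolynomial.aeval v X = P := by rw [← hP, hv]
  rw [hP'] at hX0 ⊢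
  have hconst := tensorForm_const_comul hv0 (linCoeff K k) (t m)
  have htm : MvPolynomial.aeval v (t m) = MvPolynomial.X m := by
    rw [← hv (MvPolynomial.X m), MvPolynomial.aeval_X]
  obtain ⟨Q, hQ⟩ := hcomul m
  change Algebra.TensorProduct.map (MvPolynomial.aeval t) (MvPolynomial.aeval t) Q = _ at hQ
  rw [htm, ← hQ, map_aeval_map_aeval hv] at hconst
  rw [lambda, hm, comul_add hX hshift, ← hQ, tensorDer_map_aeval ht hshift hP,
    map_aeval_map_aeval hv, map_aeval_map_aeval hv, tensorForm_tensorDer N k l hX0, hconst]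

end ShiftedSequence

/-- A polynomial in the first `N` generators is also one in all of them, so the coefficient is
unique and can be read through `v`. -/
theorem isGenCoeff_iff {N : ℕ+} {t' : {n : ℕ+ // n ≤ N} → HCK K} {t : ℕ+ → HCK K}
    (htt' : ∀ i, t' i = t i) {v : RTree → MvPolynomial ℕ+ K}
    (hv : ∀ p, MvPolynomial.aeval v (MvPolynomial.aeval t p) = p) {X : HCK K}
    (hX : X ∈ Algebra.adjoin K (Set.range t')) (i : {n : ℕ+ // n ≤ N}) {c : K} :
    IsGenCoeff t' X i c ↔ c = linCoeff K (i : ℕ+) (MvPolynomial.aeval v X) := by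
  have key : ∀ P, MvPolynomial.aeval t' P = X →
      P.coeff (Finsupp.single i 1) = linCoeff K (i : ℕ+) (MvPolynomial.aeval v X) := by
    intro P hP
    have h : MvPolynomial.aeval t (MvPolynomial.rename Subtype.val P) = X := by
      rw [MvPolynomial.aeval_rename, ← hP]
      congr 2
      ext1 i
      exact (htt' i).symm
    rw [← h, hv, linCoeff_apply, ← Finsupp.mapDomain_single,
      MvPolynomial.coeff_rename_mapDomain _ Subtype.val_injective]
  constructor
  · rintro ⟨P, hP, rfl⟩
    exact key P hP
  · rintro rfl
    rw [Algebra.adjoin_range_eq_range_aeval] at hX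
    obtain ⟨P, hP⟩ := hX
    exact ⟨P, hP, key P hP⟩

end HCK

end

theorem mainTheorem8 {K : Type*} [Field K] [CharZero K] (N : ℕ+) (t' : {n : ℕ+ // n ≤ N} → HCK K)
    (h_one : t' ⟨1, one_le⟩ = HCK.tree K RTree.single)
    (h_comb : ∀ i : {n : ℕ+ // n ≤ N}, HCK.IsNonzeroTreeComb ((i : ℕ+) : ℕ) (t' i))
    (h_hopf : HCK.IsHopfSubalgebra (Algebra.adjoin K (Set.range t')))
    (X : HCK K) (hX_mem : X ∈ Algebra.adjoin K (Set.range t')) (hX_ne : X ≠ 0)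
    (hX_prim : HCK.IsPrimitive X) (hX_deg : HCK.IsHomogeneousOfDegree (N : ℕ) X) :
    HCK.extendSeq N t' X ∈ HCK.Seq K ∧
    (∃! lam : ℕ+ → ℕ+ → K, HCK.IsLambdaArray (HCK.extendSeq N t' X) lam) ∧
    (∃! α : K, HCK.IsGenCoeff t' X ⟨N, le_rfl⟩ α) ∧
    ∀ (lam : ℕ+ → ℕ+ → K) (α : K), HCK.IsLambdaArray (HCK.extendSeq N t' X) lam →
      HCK.IsGenCoeff t' X ⟨N, le_rfl⟩ α →
      ∀ k l : ℤ, (N : ℤ) < k + l →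
        extendByZero lam k l = extendByZero lam (k - N) l + extendByZero lam k (l - N) +
          α * (k : K) * (if l = (N : ℤ) then 1 else 0) := by
  have hcomb := HCK.isNonzeroTreeComb_extendSeq h_comb hX_ne hX_deg
  have hshift := HCK.extendSeq_add t' X
  have hle := HCK.adjoin_le_adjoin_extendSeq t' X
  have htt' : ∀ i : {n : ℕ+ // n ≤ N}, t' i = HCK.extendSeq N t' X i := fun i =>
    (HCK.extendSeq_of_le t' X i.2).symm
  have hone : HCK.extendSeq N t' X 1 = HCK.tree K RTree.single := by rw [← h_one, htt']
  -- From here on, only the properties just recorded are used.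
  generalize HCK.extendSeq N t' X = t at *
  have hX_mem' := hle hX_mem
  have hcomul := HCK.comul_mem_range (fun n => (hcomb n).2) hX_prim hX_mem' hshift fun n hn => by
    have h := h_hopf.1 (t' ⟨n, hn⟩) (Algebra.subset_adjoin ⟨_, rfl⟩)
    rw [htt'] at h
    refine Algebra.TensorProduct.range_map_le ?_ h
    rwa [Subalgebra.range_val, ← Algebra.adjoin_range_eq_range_aeval]
  obtain ⟨v, hv_deg, hv⟩ := HCK.exists_leftInverse_aeval hcomb
  have hlam := fun lam => HCK.isLambdaArray_iff (lam := lam) hv hcomul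
  have hα := fun c => HCK.isGenCoeff_iff (c := c) htt' hv hX_mem ⟨N, le_rfl⟩
  refine ⟨⟨hcomb, hone, HCK.isHopfSubalgebra_adjoin (fun n => (hcomb n).2) hcomul⟩,
    ⟨_, (hlam _).2 rfl, fun lam h => (hlam lam).1 h⟩,
    ⟨_, (hα _).2 rfl, fun c h => (hα c).1 h⟩, ?_⟩
  intro lam α hlam' hα' k l hkl
  have hN : (0 : ℤ) < (N : ℕ) := by exact_mod_cast N.pos
  -- At a nonpositive index every term vanishes: `k ≤ 0` forces `l > N`, and `l ≤ 0` excludes `l =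
  -- N`.
  rcases le_or_gt k 0 with hk | hk
  · rw [extendByZero_of_left_nonpos _ hk, extendByZero_of_left_nonpos _ (by omega),
      extendByZero_of_left_nonpos _ hk, if_neg (by omega)]
    simp
  rcases le_or_gt l 0 with hl | hl
  · rw [extendByZero_of_right_nonpos _ _ hl, extendByZero_of_right_nonpos _ _ hl,
      extendByZero_of_right_nonpos _ _ (by omega), if_neg (by omega)]
    simp
  obtain ⟨k, rfl⟩ := PNat.exists_coe_eq_of_pos hk
  obtain ⟨l, rfl⟩ := PNat.exists_coe_eq_of_pos hl
  have hkl' : N < k + l := by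
    rw [← PNat.coe_lt_coe, PNat.add_coe]
    exact_mod_cast hkl
  obtain ⟨m, hm⟩ : ∃ m, k + l = m + N :=
    ⟨k + l - N, by rw [add_comm _ N, PNat.add_sub_of_lt hkl']⟩
  have hP : MvPolynomial.IsWeightedHomogeneous (fun n : ℕ+ => (n : ℕ))
      (MvPolynomial.aeval v X) N := hX_deg.aeval hv_deg
  have hv0 : ∀ u, MvPolynomial.constantCoeff (v u) = 0 := fun u =>
    (hv_deg u).coeff_eq_zero 0 (by rw [map_zero]; exact u.size_pos.ne)
  have hmain := HCK.lambda_of_add_eq (fun n => (hcomb n).2) hX_prim hshift hcomul hX_mem' hv hv0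
    (hP.coeff_eq_zero 0 (by rw [map_zero]; exact N.pos.ne)) hm
  rw [(hlam lam).1 hlam', extendByZero_coe, hmain, (hα α).1 hα']
  -- The left tensor factor carries the second index of `λ`, so the shift of `l` comes first in
  -- `hmain`.
  rw [add_comm (extendByZero _ _ _)]
  refine congrArg₂ _ (congrArg₂ _ ?_ ?_) ?_
  · rcases le_or_gt l N with hlN | hlN
    · have h0 : linCoeff K l ∘ₗ (shiftDer K N : MvPolynomial ℕ+ K →ₗ[K] _) = 0 :=
        LinearMap.ext fun p => coeff_shiftDer_of_le hlN p
      rw [h0, extendByZero_of_right_nonpos _ _ (by have : (l : ℕ) ≤ N := hlN; omega)]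
      simp [tensorForm]
    · obtain ⟨l, rfl⟩ : ∃ l', l = l' + N :=
        ⟨l - N, by rw [add_comm _ N, PNat.add_sub_of_lt hlN]⟩
      have h0 : linCoeff K (l + N) ∘ₗ (shiftDer K N : MvPolynomial ℕ+ K →ₗ[K] _) =
          linCoeff K l := LinearMap.ext fun p => coeff_shiftDer_add N l p
      obtain rfl : k + l = m := add_right_cancel ((add_assoc k l N).trans hm)
      rw [h0, PNat.add_coe, Nat.cast_add, add_sub_cancel_right, extendByZero_coe, HCK.lambda]
  · rcases le_or_gt k N with hkN | hkN
    · have h0 : linCoeff K k ∘ₗ (shiftDer K N : MvPolynomial ℕ+ K →ₗ[K] _) = 0 :=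
        LinearMap.ext fun p => coeff_shiftDer_of_le hkN p
      rw [h0, extendByZero_of_left_nonpos _ (by have : (k : ℕ) ≤ N := hkN; omega)]
      simp [tensorForm]
    · obtain ⟨k, rfl⟩ : ∃ k', k = k' + N :=
        ⟨k - N, by rw [add_comm _ N, PNat.add_sub_of_lt hkN]⟩
      have h0 : linCoeff K (k + N) ∘ₗ (shiftDer K N : MvPolynomial ℕ+ K →ₗ[K] _) =
          linCoeff K k := LinearMap.ext fun p => coeff_shiftDer_add N k p
      obtain rfl : k + l = m := add_right_cancel ((add_right_comm k l N).trans hm)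
      rw [h0, PNat.add_coe, Nat.cast_add, add_sub_cancel_right, extendByZero_coe, HCK.lambda]
  -- If `l = N`, then `k = m` and the coefficient of `X_k` in `X_m` is `1`. Otherwise `X`,
  -- homogeneous of degree `N`, has no term in `t_l`.
  · by_cases hlN : l = N
    · subst hlN
      obtain rfl : k = m := add_right_cancel hm
      simp [linCoeff_apply]
    · have h0 : linCoeff K l (MvPolynomial.aeval v X) = 0 := hP.coeff_eq_zero _ (by
        rw [Finsupp.weight_single, one_smul]
        exact fun h => hlN (PNat.eq h))
      have h1 : ((l : ℕ) : ℤ) ≠ ((N : ℕ) : ℤ) := fun h => hlN (PNat.eq (by exact_mod_cast h))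
      rw [h0, if_neg h1]
      simp
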